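/- Let $n\ge 1$, let $q,c\in\mathbb{C}^*$ and $t^{1/4}\in\mathbb{C}^*$ with $(t^{1/2}+1)(t+1)\neq 0$; equivalently, the loop weights $-(t^{1/2}+t^{-1/2})$ and $t^{1/4}+t^{-1/4}$ are both nonzero. For $N\ge 1$ let $\mathcal{L}_N$ be the set of punctured link patterns of size $N$: isotopy classes of non-crossing perfect matchings of $N$ marked points, numbered $1,\dots,N$ counter-clockwise on the boundary of a disc with one puncture, where the arcs avoid the puncture, except that for odd $N$ exactly one marked point is joined to the puncture (by the defect line). The fully nested pattern $L_\cap^{(N)}\in\mathcal{L}_N$ joins $j$ to $N+1-j$ for $1\le j\le\lfloor N/2\rfloor$, each arc separating the boundary segment between $N$ and $1$ from the puncture; for even $N$ the puncture lies next to the boundary segment between $N/2$ and $N/2+1$, and for odd $N$ the point $(N+1)/2$ is joined to the puncture. Let $V_N=\mathbb{C}[\mathcal{L}_N]$ be the link pattern module (with twist $v=1$) of the extended affine Temperley–Lieb algebra $\mathcal{TL}_N$: $\rho$ rotates a pattern, sending marked point $j$ to $j+1$, and $e_i$ joins the two strands ending at $i$ and $i+1$ and inserts a little arch between $i$ and $i+1$,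 where a null-homotopic closed loop is replaced by the factor $-(t^{1/2}+t^{-1/2})$ and a closed loop around the puncture by the factor $t^{1/4}+t^{-1/4}$. Let $V_{n+1}^{\mathcal{I}_n}$ be $V_{n+1}$ regarded as a $\mathcal{TL}_n$-module through $e_i\mapsto e_i$ $(1\le i<n)$, $\rho\mapsto\rho\,(t^{-1/4}e_n+t^{1/4})$. For $M=V_n$ or $M=V_{n+1}^{\mathcal{I}_n}$, with representation map $\sigma$, a twisted-symmetric solution of the qKZ equations with twist parameter $c$ is an element $g\in\mathbb{C}(z_1,\dots,z_n)\otimes M$ such that $$\sigma\bigl(R_i(z_{i+1}/z_i)\bigr)\,g(\dots,z_{i+1},z_i,\dots)=g(\mathbf z)\quad(1\le i<n),\qquad c^{-1}\sigma(\rho)\,g(z_2,\dots,z_n,q^{-1}z_1)=g(\mathbf z),$$ where $$R_i(x)=\frac{x-1}{t^{1/2}-t^{-1/2}x}\,e_i+\frac{x\,t^{1/2}-t^{-1/2}}{t^{1/2}-t^{-1/2}x}.$$ Write $g=\sum_L g_L L$, the sum being over $L\in\mathcal{L}_n$ if $M=V_n$ and over $L\in\mathcal{L}_{n+1}$ if $M=V_{n+1}^{\mathcal{I}_n}$,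 and let $L_\cap=L_\cap^{(n)}$, respectively $L_\cap=L_\cap^{(n+1)}$. Then, in both cases: (a) if $g_{L_\cap}=0$, then $g=0$; (b) if $g_{L_\cap}\in\mathbb{C}[z_1,\dots,z_n]$ is a homogeneous polynomial of total degree $m$, then so is $g_L$ for every $L$ (the zero polynomial being counted as homogeneous of every degree). -/

import Mathlib

/-- Punctured link patterns of size `N ≥ 1`, up to isotopy. The `N` marked points on the boundary
of the punctured disc are numbered `1, …, N` counter-clockwise, and a pattern is recorded by its
lift to the universal cover (a half plane) of the punctured disc: the lifts of the marked point
`j` are the integers congruent to `j` modulo `N`, and `m x` is the other end of the lifted arc that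
starts at `x`. The defect line runs to the puncture, i.e. to infinity in the cover; its lifts
start at the fixed points of `m`. There is at most one defect line, so, since the other classes
modulo `N` are paired by `m`, there is none for `N` even and exactly one for `N` odd.
For example, for `N = 2` the two patterns are the arc from `1` to `2` (`m 1 = 2`) and the arc
from `2` to `1` (`m 1 = 0`), each going counter-clockwise and not enclosing the puncture. -/
@[ext]
structure LinkPattern (N : ℕ) where
  m : ℤ → ℤ
  invol : ∀ x, m (m x) = x
  periodic : ∀ x, m (x + N) = m x + N
  /-- Arcs do not cross, and no arc passes between a defect and the puncture. -/
  noncrossing : ∀ i j, i < j → j < m i → i < m j ∧ m j < m i ∧ m j ≠ j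
  /-- There is at most one defect line. -/
  defect : ∀ x y, m x = x → m y = y → x ≡ y [ZMOD N]

namespace LinkPattern

theorem periodic_mul {N : ℕ} (L : LinkPattern N) (x k : ℤ) : L.m (x + N * k) = L.m x + N * k := by
  induction k using Int.induction_on with
  | zero => simp
  | succ k ih => 
    have := L.periodic (x + N * k)
    rw [show x + (N:ℤ) * (k + 1) = x + N * k + N by ring, this, ih]; ring
  | pred k ih =>
    have := L.periodic (x + N * (-k - 1))
    rw [show x + (N:ℤ) * (-k - 1) + N = x + N * (-k) by ring, ih] at this
    linarith

theorem period {N : ℕ} (L : LinkPattern N) {p q : ℤ} (h : p ≡ q [ZMOD N]) (x : ℤ) :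
    L.m (x + (q - p)) = L.m x + (q - p) := by
  obtain ⟨k, hk⟩ := h.dvd
  rw [hk, periodic_mul]

theorem fix_of_modEq {N : ℕ} (L : LinkPattern N) {p : ℤ} (h : p ≡ L.m p [ZMOD N]) : L.m p = p := by
  have h1 := L.period h p
  have h2 := L.invol p
  rw [show p + (L.m p - p) = L.m p by ring] at h1
  omega

open Classical in
/-- The arcs of the diagram `e_i L` (loops removed): `i` and `i + 1` are joined by a little arch,
and the two strands of `L` that ended at `i` and `i + 1` are joined to each other. If one of those
two strands is the defect line, the far end of the other strand becomes the new defect. -/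
noncomputable def capFun {N : ℕ} (L : LinkPattern N) (i x : ℤ) : ℤ :=
  if x ≡ i [ZMOD N] then x + 1
  else if x ≡ i + 1 [ZMOD N] then x - 1
  else if L.m x ≡ i [ZMOD N] then
    if L.m (L.m x + 1) = L.m x + 1 then x else L.m (L.m x + 1)
  else if L.m x ≡ i + 1 [ZMOD N] then
    if L.m (L.m x - 1) = L.m x - 1 then x else L.m (L.m x - 1)
  else L.m x

/-- The diagram `ρ L`: the marked point `j` is moved to `j + 1`. -/
def rotate {N : ℕ} (L : LinkPattern N) : LinkPattern N where
  m x := L.m (x - 1) + 1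
  invol x := by simp [L.invol]
  periodic x := by
    rw [show x + (N:ℤ) - 1 = x - 1 + N by ring, L.periodic]; ring
  noncrossing i j h1 h2 := by
    have := L.noncrossing (i - 1) (j - 1) (by omega) (by omega)
    omega
  defect x y hx hy := by
    have := L.defect (x - 1) (y - 1) (by omega) (by omega)
    simpa using this.add_right 1


/-- The arcs of the fully nested diagram. With `k = ⌈N / 2⌉`, the integers
`k - N + 1, …, k` represent the marked points; on them `m x = 1 - x`, i.e. `1` is joined to `N`,
`2` to `N - 1`, and so on, by arcs through the boundary segment between `N` and `1`, except that
for `N` odd the middle point `k` carries the defect line. The puncture is thus next to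
the boundary between `k` and `k + 1` when `N = 2 * k`. -/
def nestedFun (N : ℕ) (x : ℤ) : ℤ :=
  let k : ℤ := (N + 1) / 2
  let s : ℤ := (x + (N - 1 - k)) / N
  if Odd N ∧ x - N * s = k then x else 1 - x + 2 * (N * s)

theorem nestedFun_add (N : ℕ) [NeZero N] (y s : ℤ) (h1 : -(N - 1 - (N + 1) / 2) ≤ y)
    (h2 : y ≤ ((N : ℤ) + 1) / 2) : nestedFun N (y + N * s) =
      if Odd N ∧ y = ((N : ℤ) + 1) / 2 then y + N * s else 1 - y + N * s := by
  have hN : (0 : ℤ) < N := by exact_mod_cast NeZero.pos N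
  have : (y + N * s + (N - 1 - ((N : ℤ) + 1) / 2)) / N = s := by
    rw [Int.ediv_eq_iff_of_pos hN]
    constructor <;> rw [mul_comm s] <;> omega
  simp only [nestedFun, this]
  grind

theorem nested_decomp (N : ℕ) [NeZero N] (x : ℤ) : ∃ y s : ℤ, x = y + N * s ∧
    -(N - 1 - ((N : ℤ) + 1) / 2) ≤ y ∧ y ≤ ((N : ℤ) + 1) / 2 := by
  have hN : (0 : ℤ) < N := by exact_mod_cast NeZero.pos N
  have h1 := Int.emod_add_mul_ediv (x + (N - 1 - ((N : ℤ) + 1) / 2)) N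
  have h2 := Int.emod_nonneg (x + (N - 1 - ((N : ℤ) + 1) / 2)) hN.ne'
  have h3 := Int.emod_lt_of_pos (x + (N - 1 - ((N : ℤ) + 1) / 2)) hN
  refine ⟨x - N * ((x + (N - 1 - ((N : ℤ) + 1) / 2)) / N),
    (x + (N - 1 - ((N : ℤ) + 1) / 2)) / N, by ring, ?_, ?_⟩ <;> omega

/-- The fully nested diagram `L_∩` of size `N`. -/
def fullyNested (N : ℕ) [NeZero N] : LinkPattern N where
  m := nestedFun N
  invol x := by
    obtain ⟨y, s, rfl, h1, h2⟩ := nested_decomp N x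
    rw [nestedFun_add N y s h1 h2]
    split_ifs with h
    · rw [nestedFun_add N y s h1 h2, if_pos h]
    · have : ¬ (Odd N ∧ 1 - y = ((N : ℤ) + 1) / 2) := by
        rintro ⟨h3, h4⟩
        obtain ⟨r, rfl⟩ := h3
        omega
      have h5 : 1 - y ≤ ((N : ℤ) + 1) / 2 := by omega
      have h6 : -(N - 1 - ((N : ℤ) + 1) / 2) ≤ 1 - y := by
        rcases Nat.even_or_odd N with h7 | h7
        · obtain ⟨r, rfl⟩ := h7
          push_cast at *; omega
        · have : y ≠ ((N : ℤ) + 1) / 2 := fun h8 => h ⟨h7, h8⟩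
          obtain ⟨r, rfl⟩ := h7
          push_cast at *; omega
      rw [nestedFun_add N (1 - y) s h6 h5, if_neg this]; ring
  periodic x := by
    obtain ⟨y, s, rfl, h1, h2⟩ := nested_decomp N x
    rw [show y + (N : ℤ) * s + N = y + N * (s + 1) by ring, nestedFun_add N y s h1 h2,
      nestedFun_add N y (s + 1) h1 h2]
    split_ifs <;> ring
  noncrossing i j h3 h4 := by
    obtain ⟨y, s, rfl, h1, h2⟩ := nested_decomp N i
    obtain ⟨y', s', rfl, h1', h2'⟩ := nested_decomp N j
    rw [nestedFun_add N y s h1 h2] at *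
    rw [nestedFun_add N y' s' h1' h2'] at *
    have hN : (0 : ℤ) < N := by exact_mod_cast NeZero.pos N
    rcases lt_trichotomy s s' with hs | rfl | hs
    · have : (N : ℤ) * s + N ≤ N * s' := by nlinarith
      split_ifs at * with h5 <;> omega
    · rcases Nat.even_or_odd N with h7 | h7
      · have : ¬ Odd N := by simpa using h7
        simp only [this, false_and, if_false] at *
        omega
      · simp only [h7, true_and] at *
        obtain ⟨r, rfl⟩ := h7
        split_ifs at * <;> omega
    · have : (N : ℤ) * s' + N ≤ N * s := by nlinarith
      split_ifs at * with h5 <;> omega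
  defect x y hx hy := by
    obtain ⟨a, s, rfl, h1, h2⟩ := nested_decomp N x
    obtain ⟨b, s', rfl, h1', h2'⟩ := nested_decomp N y
    rw [nestedFun_add N a s h1 h2] at hx
    rw [nestedFun_add N b s' h1' h2'] at hy
    split_ifs at hx with h3
    · split_ifs at hy with h4
      · rw [h3.2, h4.2]
        exact (Int.modEq_iff_dvd.2 ⟨s' - s, by ring⟩)
      · omega
    · omega

theorem not_modEq_succ {N : ℕ} (hN : 2 ≤ N) (p : ℤ) : ¬ (p + 1 ≡ p [ZMOD N]) := by
  intro h
  have := (h.symm.dvd)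
  have h2 : (N : ℤ) ∣ 1 := by simpa using this
  have := Int.le_of_dvd one_pos h2
  omega


theorem modEq_sub_one {N : ℕ} {x i : ℤ} : x ≡ i + 1 [ZMOD N] ↔ x - 1 ≡ i [ZMOD N] := by
  constructor
  · intro h; simpa using h.sub_right 1
  · intro h; simpa using h.add_right 1

theorem not_both {N : ℕ} (hN : 2 ≤ N) {x i : ℤ} (h1 : x ≡ i [ZMOD N]) (h2 : x - 1 ≡ i [ZMOD N]) :
    False := by
  have := (h1.trans h2.symm).symm.dvd
  have h2 : (N : ℤ) ∣ 1 := by simpa using this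
  have := Int.le_of_dvd one_pos h2
  omega

theorem capFun_of_left {N : ℕ} (L : LinkPattern N) {i x : ℤ} (h : x ≡ i [ZMOD N]) :
    L.capFun i x = x + 1 := by simp [capFun, h]

theorem capFun_of_right {N : ℕ} (hN : 2 ≤ N) (L : LinkPattern N) {i x : ℤ} (h : x - 1 ≡ i [ZMOD N]) :
    L.capFun i x = x - 1 := by
  have h1 : ¬ x ≡ i [ZMOD N] := fun h' => not_both hN h' h
  simp [capFun, h1, modEq_sub_one, h]

theorem capFun_cases {N : ℕ} (hN : 2 ≤ N) (L : LinkPattern N) (i x : ℤ) :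
    (x ≡ i [ZMOD N] ∧ L.capFun i x = x + 1) ∨
    (x - 1 ≡ i [ZMOD N] ∧ L.capFun i x = x - 1) ∨
    (¬ x ≡ i [ZMOD N] ∧ ¬ x - 1 ≡ i [ZMOD N] ∧
      ((∃ p, p ≡ i [ZMOD N] ∧ L.m p = x ∧ L.m x = p ∧
          (L.m (p + 1) = p + 1 ∧ L.capFun i x = x ∨
            L.m (p + 1) ≠ p + 1 ∧ L.capFun i x = L.m (p + 1))) ∨
       (∃ p, p ≡ i [ZMOD N] ∧ L.m (p + 1) = x ∧ L.m x = p + 1 ∧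
          (L.m p = p ∧ L.capFun i x = x ∨ L.m p ≠ p ∧ L.capFun i x = L.m p)) ∨
       (¬ L.m x ≡ i [ZMOD N] ∧ ¬ L.m x - 1 ≡ i [ZMOD N] ∧ L.capFun i x = L.m x))) := by
  by_cases h1 : x ≡ i [ZMOD N]
  · exact Or.inl ⟨h1, L.capFun_of_left h1⟩
  by_cases h2 : x - 1 ≡ i [ZMOD N]
  · exact Or.inr (Or.inl ⟨h2, L.capFun_of_right hN h2⟩)
  refine Or.inr (Or.inr ⟨h1, h2, ?_⟩)
  by_cases h3 : L.m x ≡ i [ZMOD N]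
  · refine Or.inl ⟨L.m x, h3, L.invol x, rfl, ?_⟩
    by_cases h4 : L.m (L.m x + 1) = L.m x + 1
    · left; simp [capFun, modEq_sub_one, h1, h2, h3, h4]
    · right; simp [capFun, modEq_sub_one, h1, h2, h3, h4]
  by_cases h4 : L.m x - 1 ≡ i [ZMOD N]
  · refine Or.inr (Or.inl ⟨L.m x - 1, h4, by simp [L.invol], by ring, ?_⟩)
    by_cases h5 : L.m (L.m x - 1) = L.m x - 1
    · left; simp [capFun, modEq_sub_one, h1, h2, h3, h4, h5]
    · right; simp [capFun, modEq_sub_one, h1, h2, h3, h4, h5]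
  · exact Or.inr (Or.inr ⟨h3, h4, by simp [capFun, modEq_sub_one, h1, h2, h3, h4]⟩)

theorem modEq_add_N {N : ℕ} {x i : ℤ} : x + N ≡ i [ZMOD N] ↔ x ≡ i [ZMOD N] := by
  simp [Int.ModEq]

theorem capFun_periodic {N : ℕ} (L : LinkPattern N) (i x : ℤ) :
    L.capFun i (x + N) = L.capFun i x + N := by
  have e1 : ∀ y : ℤ, y + N + 1 = y + 1 + N := fun y => by ring
  have e2 : ∀ y : ℤ, y + N - 1 = y - 1 + N := fun y => by ring
  simp only [capFun, modEq_add_N, L.periodic, e1, e2, add_left_inj]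
  split_ifs <;> rfl


theorem capFun_invol {N : ℕ} (hN : 2 ≤ N) (L : LinkPattern N) (i x : ℤ) :
    L.capFun i (L.capFun i x) = x := by
  rcases L.capFun_cases hN i x with ⟨h, e⟩ | ⟨h, e⟩ | ⟨h1, h2, ⟨p, hp, hx, hx', ⟨h3, e⟩ | ⟨h3, e⟩⟩ |
    ⟨p, hp, hx, hx', ⟨h3, e⟩ | ⟨h3, e⟩⟩ | ⟨h3, h4, e⟩⟩
  · rw [e, L.capFun_of_right hN (by simpa using h)]; ring
  · rw [e, L.capFun_of_left h]; ring
  · rw [e, e]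
  · have a1 : ¬ L.m (p + 1) ≡ i [ZMOD N] := by
      intro h
      have h4 := L.period (hp.trans h.symm) p
      have h5 := L.invol (p + 1)
      rw [show p + (L.m (p + 1) - p) = L.m (p + 1) by ring, h5, hx] at h4
      apply h2
      have : x - 1 = p - (L.m (p + 1) - p) := by omega
      rw [this]
      simpa using hp.sub (h.sub hp)
    have a2 : ¬ L.m (p + 1) - 1 ≡ i [ZMOD N] := by
      intro h
      exact h3 (L.fix_of_modEq (by simpa using ((hp.trans h.symm).add_right 1)))
    have a3 : ¬ p + 1 ≡ i [ZMOD N] := fun h => not_both hN h (by simpa using hp)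
    have a4 : x ≠ p := fun h => h1 (h ▸ hp)
    rw [e]
    simp [capFun, modEq_sub_one, a1, a2, a3, a4, hp, L.invol, hx]
  · rw [e, e]
  · have a1 : ¬ L.m p - 1 ≡ i [ZMOD N] := by
      intro h
      have h4 := L.period (hp.trans h.symm) (p + 1)
      have h5 := L.invol p
      rw [show p + 1 + (L.m p - 1 - p) = L.m p by ring, h5, hx] at h4
      apply h1
      have : x = p - (L.m p - 1 - p) := by omega
      rw [this]
      simpa using hp.sub (h.sub hp)
    have a2 : ¬ L.m p ≡ i [ZMOD N] := fun h => h3 (L.fix_of_modEq (hp.trans h.symm))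
    have a4 : x ≠ p + 1 := fun h => h2 (by simpa [h] using hp)
    rw [e]
    simp [capFun, modEq_sub_one, a1, a2, a4, hp, L.invol, hx]
  · rw [e]
    simp [capFun, modEq_sub_one, L.invol, h1, h2, h3, h4]


theorem side_old {N : ℕ} (L : LinkPattern N) (x z : ℤ) (h1 : z ≠ x) (h2 : z ≠ L.m x) :
    (L.m z = z → ¬ (min x (L.m x) < z ∧ z < max x (L.m x))) ∧
    ((min x (L.m x) < z ∧ z < max x (L.m x)) ↔
      (min x (L.m x) < L.m z ∧ L.m z < max x (L.m x))) := by
  have a1 := L.noncrossing x z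
  have a2 := L.noncrossing (L.m x) z
  have a3 := L.noncrossing x (L.m z)
  have a4 := L.noncrossing (L.m x) (L.m z)
  have h3 : L.m z ≠ x := fun h => h2 (by rw [← h, L.invol])
  have h4 : L.m z ≠ L.m x := fun h => h1 (by rw [← L.invol x, ← h, L.invol])
  simp only [L.invol] at a1 a2 a3 a4
  omega

theorem side_new {N : ℕ} (L : LinkPattern N) (p z : ℤ) (hz : z ≠ p) (hz' : z ≠ p + 1)
    (h1 : z ≠ L.m p) (h2 : z ≠ L.m (p + 1))
    (hp : L.m p ≠ p + 1) (hq : L.m p ≠ p) (hq' : L.m (p + 1) ≠ p + 1) :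
    (L.m z = z → ¬ (min (L.m p) (L.m (p + 1)) < z ∧ z < max (L.m p) (L.m (p + 1)))) ∧
    ((min (L.m p) (L.m (p + 1)) < z ∧ z < max (L.m p) (L.m (p + 1))) ↔
      (min (L.m p) (L.m (p + 1)) < L.m z ∧ L.m z < max (L.m p) (L.m (p + 1)))) := by
  have a1 := L.side_old p z hz h1
  have a2 := L.side_old (p + 1) z hz' h2
  have h3 : L.m z ≠ p := fun h => h1 (by rw [← h, L.invol])
  have h4 : L.m z ≠ p + 1 := fun h => h2 (by rw [← h, L.invol])
  have h5 : L.m z ≠ L.m p := fun h => hz (by rw [← L.invol p, ← h, L.invol])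
  have h6 : L.m z ≠ L.m (p + 1) := fun h => hz' (by rw [← L.invol (p + 1), ← h, L.invol])
  have h7 : L.m (p + 1) ≠ p := fun h => hp (by rw [← L.invol (p + 1), h])
  omega


theorem side_cap {N : ℕ} (hN : 2 ≤ N) (L : LinkPattern N) (i a b : ℤ)
    (ha : ¬ a ≡ i [ZMOD N]) (ha' : ¬ a - 1 ≡ i [ZMOD N])
    (hb : ¬ b ≡ i [ZMOD N]) (hb' : ¬ b - 1 ≡ i [ZMOD N])
    (H : ∀ z, z ≠ a → z ≠ b →
      (∀ p, p ≡ i [ZMOD N] → (L.m p = a ∨ L.m p = b) → (L.m (p + 1) = a ∨ L.m (p + 1) = b) →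
        z ≠ p ∧ z ≠ p + 1) →
      (L.m z = z → ¬ (min a b < z ∧ z < max a b)) ∧
      ((min a b < z ∧ z < max a b) ↔ (min a b < L.m z ∧ L.m z < max a b)))
    (y : ℤ) (hya : y ≠ a) (hyb : y ≠ b) :
    (L.capFun i y = y → ¬ (min a b < y ∧ y < max a b)) ∧
    ((min a b < y ∧ y < max a b) ↔ (min a b < L.capFun i y ∧ L.capFun i y < max a b)) := by
  have Q : ∀ z, ¬ z ≡ i [ZMOD N] → ¬ z - 1 ≡ i [ZMOD N] → ∀ p, p ≡ i [ZMOD N] →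
      z ≠ p ∧ z ≠ p + 1 := by
    intro z h1 h2 p hp
    constructor
    · rintro rfl; exact h1 hp
    · rintro rfl; exact h2 (by simpa using hp)
  have Qa := Q a ha ha'
  have Qb := Q b hb hb'
  rcases L.capFun_cases hN i y with ⟨h, e⟩ | ⟨h, e⟩ | ⟨h1, h2, ⟨q, hq, hx, hx', h3⟩ |
    ⟨q, hq, hx, hx', h3⟩ | ⟨h3, h4, e⟩⟩
  · have := Qa y h
    have := Qb y h
    omega
  · have := Qa _ h
    have := Qb _ h
    omega
  · have A := H y hya hyb fun p hp _ _ => Q y h1 h2 p hp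
    have hqa := Qa q hq
    have hqb := Qb q hq
    have B := H (q + 1) hqa.2.symm hqb.2.symm fun p hp hp' _ => by
      refine ⟨?_, ?_⟩
      · rintro rfl; exact not_both hN hp (by simpa using hq)
      · intro h
        obtain rfl : q = p := by omega
        omega
    rw [hx'] at A
    have hne : L.m (q + 1) ≠ y := fun h => by
      have := L.invol (q + 1)
      rw [h] at this; omega
    rcases h3 with ⟨h3, e⟩ | ⟨h3, e⟩ <;> rw [e] <;> omega
  · have A := H y hya hyb fun p hp _ _ => Q y h1 h2 p hp
    have hqa := Qa q hq
    have hqb := Qb q hq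
    have B := H q hqa.1.symm hqb.1.symm fun p hp _ hp' => by
      refine ⟨?_, ?_⟩
      · rintro rfl; omega
      · rintro rfl; exact not_both hN hq (by simpa using hp)
    rw [hx'] at A
    have hne : L.m q ≠ y := fun h => by
      have := L.invol q
      rw [h] at this; omega
    rcases h3 with ⟨h3, e⟩ | ⟨h3, e⟩ <;> rw [e] <;> omega
  · have A := H y hya hyb fun p hp _ _ => Q y h1 h2 p hp
    rw [e]
    exact A

theorem nonend {N : ℕ} (L : LinkPattern N) {i p : ℤ} (hp : p ≡ i [ZMOD N])
    (h2 : ¬ L.m p - 1 ≡ i [ZMOD N]) (h3 : L.m (p + 1) ≠ p + 1) :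
    ¬ L.m (p + 1) ≡ i [ZMOD N] ∧ ¬ L.m (p + 1) - 1 ≡ i [ZMOD N] := by
  constructor
  · intro h
    have h4 := L.period (hp.trans h.symm) p
    have h5 := L.invol (p + 1)
    rw [show p + (L.m (p + 1) - p) = L.m (p + 1) by ring, h5] at h4
    apply h2
    have : L.m p - 1 = p - (L.m (p + 1) - p) := by omega
    rw [this]
    simpa using hp.sub (h.sub hp)
  · intro h
    exact h3 (L.fix_of_modEq (by simpa using ((hp.trans h.symm).add_right 1)))

theorem nonend' {N : ℕ} (L : LinkPattern N) {i p : ℤ} (hp : p ≡ i [ZMOD N])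
    (h1 : ¬ L.m (p + 1) ≡ i [ZMOD N]) (h3 : L.m p ≠ p) :
    ¬ L.m p ≡ i [ZMOD N] ∧ ¬ L.m p - 1 ≡ i [ZMOD N] := by
  constructor
  · exact fun h => h3 (L.fix_of_modEq (hp.trans h.symm))
  · intro h
    have h4 := L.period (hp.trans h.symm) (p + 1)
    have h5 := L.invol p
    rw [show p + 1 + (L.m p - 1 - p) = L.m p by ring, h5] at h4
    apply h1
    have : L.m (p + 1) = p - (L.m p - 1 - p) := by omega
    rw [this]
    simpa using hp.sub (h.sub hp)

theorem capFun_noncrossing {N : ℕ} (hN : 2 ≤ N) (L : LinkPattern N) (i x y : ℤ) (hxy : x < y)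
    (hy : y < L.capFun i x) :
    x < L.capFun i y ∧ L.capFun i y < L.capFun i x ∧ L.capFun i y ≠ y := by
  suffices h : (L.capFun i y = y → ¬ (min x (L.capFun i x) < y ∧ y < max x (L.capFun i x))) ∧
    ((min x (L.capFun i x) < y ∧ y < max x (L.capFun i x)) ↔
      (min x (L.capFun i x) < L.capFun i y ∧ L.capFun i y < max x (L.capFun i x))) by omega
  have notsucc : ∀ p, p ≡ i [ZMOD N] → ¬ p + 1 ≡ i [ZMOD N] :=
    fun p hp h => not_both hN h (by simpa using hp)
  rcases L.capFun_cases hN i x with ⟨h, e⟩ | ⟨h, e⟩ | ⟨h1, h2, ⟨p, hp, hx, hx', ⟨h3, e⟩ | ⟨h3, e⟩⟩ |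
    ⟨p, hp, hx, hx', ⟨h3, e⟩ | ⟨h3, e⟩⟩ | ⟨h3, h4, e⟩⟩
  · omega
  · omega
  · omega
  · subst hx
    have hn := L.nonend hp h2 h3
    rw [e] at hy ⊢
    refine L.side_cap hN i _ _ h1 h2 hn.1 hn.2 (fun z hza hzb hz => ?_) y (by omega) (by omega)
    have hz' := hz p hp (Or.inl rfl) (Or.inr rfl)
    refine L.side_new p z hz'.1 hz'.2 hza hzb ?_ ?_ h3
    · intro h; rw [h] at h2; exact h2 (by simpa using hp)
    · intro h; rw [h] at h1; exact h1 hp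
  · omega
  · subst hx
    have hn := L.nonend' hp h1 h3
    rw [e] at hy ⊢
    refine L.side_cap hN i _ _ h1 h2 hn.1 hn.2 (fun z hza hzb hz => ?_) y (by omega) (by omega)
    have hz' := hz p hp (Or.inr rfl) (Or.inl rfl)
    rw [min_comm, max_comm]
    refine L.side_new p z hz'.1 hz'.2 hzb hza ?_ h3 ?_
    · intro h; rw [h] at hn; exact hn.2 (by simpa using hp)
    · intro h; rw [h] at h2; exact h2 (by simpa using hp)
  · rw [e] at hy ⊢
    exact L.side_cap hN i _ _ h1 h2 h3 h4 (fun z hza hzb _ => L.side_old x z hza hzb) y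
      (by omega) (by omega)

theorem capFun_defect {N : ℕ} (hN : 2 ≤ N) (L : LinkPattern N) (i x y : ℤ)
    (hx : L.capFun i x = x) (hy : L.capFun i y = y) : x ≡ y [ZMOD N] := by
  have key : ∀ x, L.capFun i x = x → ∃ d, L.m d = d ∧ 
      (d ≡ i [ZMOD N] → ∃ p, p ≡ i [ZMOD N] ∧ p = d ∧ x = L.m (p + 1)) ∧
      (d - 1 ≡ i [ZMOD N] → ∃ p, p ≡ i [ZMOD N] ∧ p + 1 = d ∧ x = L.m p) ∧
      (¬ d ≡ i [ZMOD N] → ¬ d - 1 ≡ i [ZMOD N] → x = d) := by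
    intro x hx
    rcases L.capFun_cases hN i x with ⟨h, e⟩ | ⟨h, e⟩ | ⟨h1, h2, ⟨p, hp, hm, hm', ⟨h3, e⟩ | ⟨h3, e⟩⟩ |
      ⟨p, hp, hm, hm', ⟨h3, e⟩ | ⟨h3, e⟩⟩ | ⟨h3, h4, e⟩⟩
    · omega
    · omega
    · exact ⟨p + 1, h3, fun h => (not_both hN h (by simpa using hp)).elim,
        fun _ => ⟨p, hp, rfl, hm.symm⟩, fun _ h => (h (by simpa using hp)).elim⟩
    · exfalso
      have : L.m x = p + 1 := by rw [← hx, e, L.invol]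
      omega
    · exact ⟨p, h3, fun _ => ⟨p, hp, rfl, hm.symm⟩, fun h => (not_both hN hp h).elim,
        fun h => (h hp).elim⟩
    · exfalso
      have : L.m x = p := by rw [← hx, e, L.invol]
      omega
    · exact ⟨x, by omega, fun h => (h1 h).elim, fun h => (h2 h).elim, fun _ _ => rfl⟩
  obtain ⟨d, hd, a1, a2, a3⟩ := key x hx
  obtain ⟨d', hd', b1, b2, b3⟩ := key y hy
  have hdd := L.defect d d' hd hd'
  have hm : ∀ p q : ℤ, p ≡ q [ZMOD N] → L.m p ≡ L.m q [ZMOD N] := by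
    intro p q h
    have := L.period h p
    rw [show p + (q - p) = q by ring] at this
    rw [this]
    exact Int.modEq_iff_dvd.2 (by simpa using h.dvd)
  by_cases c1 : d ≡ i [ZMOD N]
  · obtain ⟨p, hp, rfl, rfl⟩ := a1 c1
    obtain ⟨q, hq, rfl, rfl⟩ := b1 (hdd.symm.trans c1)
    exact hm _ _ (hdd.add_right 1)
  by_cases c2 : d - 1 ≡ i [ZMOD N]
  · obtain ⟨p, hp, rfl, rfl⟩ := a2 c2
    obtain ⟨q, hq, rfl, rfl⟩ := b2 ((hdd.symm.sub_right 1).trans c2)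
    exact hm _ _ (hp.trans hq.symm)
  · rw [a3 c1 c2, b3 (fun h => c1 (hdd.trans h)) (fun h => c2 ((hdd.sub_right 1).trans h))]
    exact hdd

/-- The diagram `e_i L` with loops removed (`N ≥ 2`; there is no `e_i` for `N = 1`). -/
noncomputable def cap {N : ℕ} (L : LinkPattern N) (i : ℤ) : LinkPattern N :=
  if hN : 2 ≤ N then
    { m := L.capFun i
      invol := L.capFun_invol hN i
      periodic := L.capFun_periodic i
      noncrossing := L.capFun_noncrossing hN i
      defect := L.capFun_defect hN i }
  else L

/-- The scalar by which `e_i L` differs from `L.cap i`: `-(t^{1/2} + t^{-1/2})` if `e_i L` has a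
null-homotopic loop, `t^{1/4} + t^{-1/4}` if it has a loop around the puncture, and `1` if it has no
loop. Here `τ = t^{1/4}`. -/
noncomputable def loopWeight {N : ℕ} (τ : ℂˣ) (i : ℤ) (L : LinkPattern N) : ℂ :=
  if L.m i = i + 1 then -((τ : ℂ) ^ 2 + ((τ : ℂ) ^ 2)⁻¹)
  else if L.m (i + 1) = i + N then (τ : ℂ) + (τ : ℂ)⁻¹
  else 1

end LinkPattern

/-- The field `ℂ(z_1, …, z_n)`. -/
abbrev RatFun (n : ℕ) : Type := FractionRing (MvPolynomial (Fin n) ℂ)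

namespace RatFun

/-- The variables; `z k` is `z_{k+1}` in the numbering `z_1, …, z_n`. -/
noncomputable def z {n : ℕ} (k : Fin n) : RatFun n :=
  algebraMap (MvPolynomial (Fin n) ℂ) (RatFun n) (MvPolynomial.X k)

open MvPolynomial in
/-- The automorphism of the polynomial ring that substitutes `w j * z (π j)` for `z j`. -/
noncomputable def polySubst {n : ℕ} (π : Equiv.Perm (Fin n)) (w : Fin n → ℂˣ) :
    MvPolynomial (Fin n) ℂ ≃ₐ[ℂ] MvPolynomial (Fin n) ℂ :=
  AlgEquiv.ofAlgHom
    (aeval fun j => C (w j : ℂ) * X (π j))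
    (aeval fun j => C ((w (π.symm j))⁻¹ : ℂˣ).val * X (π.symm j))
    (by ext j; simp [← mul_assoc, ← C_mul, algHom_C])
    (by ext j; simp [← mul_assoc, ← C_mul, algHom_C])

/-- The same substitution on rational functions. -/
noncomputable def subst {n : ℕ} (π : Equiv.Perm (Fin n)) (w : Fin n → ℂˣ) :
    RatFun n ≃+* RatFun n :=
  IsFractionRing.ringEquivOfRingEquiv (polySubst π w).toRingEquiv

/-- `f ↦ f(…, z j, z i, …)`, the exchange of two variables. -/
noncomputable def swapVars {n : ℕ} (i j : Fin n) : RatFun n ≃+* RatFun n :=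
  subst (Equiv.swap i j) fun _ => 1

/-- `f ↦ f(z_2, …, z_n, q⁻¹ z_1)`. -/
noncomputable def cycleVars {n : ℕ} (q : ℂˣ) : RatFun n ≃+* RatFun n :=
  subst (finRotate n) fun j => if (j : ℕ) + 1 = n then q⁻¹ else 1

/-- The rational function `f` is a homogeneous polynomial of total degree `d`. -/
def IsHomogeneousPoly {n : ℕ} (f : RatFun n) (d : ℕ) : Prop :=
  ∃ p : MvPolynomial (Fin n) ℂ, p.IsHomogeneous d ∧
    algebraMap (MvPolynomial (Fin n) ℂ) (RatFun n) p = f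

end RatFun

/-- The space `ℂ(z_1, …, z_n) ⊗ ℂ[𝓛_N]` of rational functions with values in the
link pattern module `V_N`; `g L` is the component of `g` at `L`. -/
abbrev LinkModule (n N : ℕ) : Type := LinkPattern N →₀ RatFun n

namespace LinkModule

/-- The action of the Temperley-Lieb generator `e_i` on `V_N`, extended linearly. -/
noncomputable def e (n N : ℕ) (τ : ℂˣ) (i : ℤ) : Module.End (RatFun n) (LinkModule n N) :=
  Finsupp.linearCombination (RatFun n) fun L =>
    Finsupp.single (L.cap i) (algebraMap ℂ (RatFun n) (L.loopWeight τ i))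

/-- The action of the Temperley-Lieb generator `ρ` on `V_N` (with twist parameter `v = 1`), extended
linearly. -/
noncomputable def rho (n N : ℕ) : Module.End (RatFun n) (LinkModule n N) :=
  Finsupp.lmapDomain (RatFun n) (RatFun n) LinkPattern.rotate

/-- The action of `ρ ∈ TL_n` on the restriction of `V_{n+1}` along
`I_n : TL_n → TL_{n+1}`, `e_i ↦ e_i` (`1 ≤ i < n`), `ρ ↦ ρ (t^{-1/4} e_n + t^{1/4})`. -/
noncomputable def rhoRes (n : ℕ) (τ : ℂˣ) : Module.End (RatFun n) (LinkModule n (n + 1)) :=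
  rho n (n + 1) * (((τ : ℂ)⁻¹) • e n (n + 1) τ n + (τ : ℂ) • 1)

/-- The action of a substitution of variables on all components. -/
noncomputable def mapCoeff {n N : ℕ} (σ : RatFun n ≃+* RatFun n) (g : LinkModule n N) :
    LinkModule n N :=
  Finsupp.mapRange σ (map_zero σ) g

end LinkModule

/-- The weight `a(x) = (x - 1) / (t^{1/2} - t^{-1/2} x)`, with `τ = t^{1/4}`. -/
noncomputable def weightA {n : ℕ} (τ : ℂˣ) (x : RatFun n) : RatFun n :=
  (x - 1) / (algebraMap ℂ (RatFun n) ((τ : ℂ) ^ 2) - algebraMap ℂ (RatFun n) ((τ : ℂ) ^ 2)⁻¹ * x)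

/-- The weight `b(x) = (x t^{1/2} - t^{-1/2}) / (t^{1/2} - t^{-1/2} x)`, with `τ = t^{1/4}`. -/
noncomputable def weightB {n : ℕ} (τ : ℂˣ) (x : RatFun n) : RatFun n :=
  (x * algebraMap ℂ (RatFun n) ((τ : ℂ) ^ 2) - algebraMap ℂ (RatFun n) ((τ : ℂ) ^ 2)⁻¹) /
    (algebraMap ℂ (RatFun n) ((τ : ℂ) ^ 2) - algebraMap ℂ (RatFun n) ((τ : ℂ) ^ 2)⁻¹ * x)

/-- Twisted-symmetric solutions of the qKZ equations with twist parameter `c`, for the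
`TL_n`-module structure on `ℂ[𝓛_N]` in which the generators `e_i` and `ρ` act by `E i` and `P`:
the elements invariant under `∇(s_i)` (`1 ≤ i < n`) and `∇(ρ)`, which generate the action
of the extended affine symmetric group. -/
structure IsTwistedSymmetric {n N : ℕ} (τ q c : ℂˣ)
    (E : ℤ → Module.End (RatFun n) (LinkModule n N)) (P : Module.End (RatFun n) (LinkModule n N))
    (g : LinkModule n N) : Prop where
  /-- `R_i(z_{i+1} / z_i) g(…, z_{i+1}, z_i, …) = g(z)` for `1 ≤ i < n`, where
  `R_i(x) = a(x) e_i + b(x)`. The index `k` is `i - 1`. -/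
  exchange : ∀ (k : ℕ) (hk : k + 1 < n),
    let z₁ : Fin n := ⟨k, Nat.lt_of_succ_lt hk⟩
    let z₂ : Fin n := ⟨k + 1, hk⟩
    let x : RatFun n := RatFun.z z₂ / RatFun.z z₁
    (weightA τ x • E (k + 1) + weightB τ x • 1 : Module.End (RatFun n) (LinkModule n N))
      (LinkModule.mapCoeff (RatFun.swapVars z₁ z₂) g) = g
  /-- `c⁻¹ ρ g(z_2, …, z_n, q⁻¹ z_1) = g(z)`. -/
  cyclic : ((c : ℂ)⁻¹) • P (LinkModule.mapCoeff (RatFun.cycleVars q) g) = g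

/-- Twisted-symmetric qKZ solutions with values in `V_n`. -/
def IsSolution (n : ℕ) (τ q c : ℂˣ) (g : LinkModule n n) : Prop :=
  IsTwistedSymmetric τ q c (LinkModule.e n n τ) (LinkModule.rho n n) g

/-- Twisted-symmetric qKZ solutions with values in the restriction of `V_{n+1}` along `I_n`. -/
def IsRestrictedSolution (n : ℕ) (τ q c : ℂˣ) (g : LinkModule n (n + 1)) : Prop :=
  IsTwistedSymmetric τ q c (LinkModule.e n (n + 1) τ) (LinkModule.rhoRes n τ) g

/-!
Both parts are one statement about a space `S` of rational functions that is stable under the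
exchange of two variables, the cyclic shift of the variables in both directions, and the divided
differences `f ↦ (t^{1/2} z_i - t^{-1/2} z_j) (f - s_{ij} f) / (z_j - z_i)` (`RatFun.IsStable`): if
the component of a solution at the fully nested pattern is in `S`, then so are all components. Take
`S = 0` for part (a), and for part (b) the homogeneous polynomials of a given degree, to which the
divided difference applies because `z_j - z_i` divides `p - s_{ij} p`.

Call `i` a valley of a pattern `p` if the arcs at `i` and `i + 1` go to the left and to the right
and are not one arc around the puncture. Then `e_i p` contains no loop, and has an arch at `i`
inside the arc that joins the former partners of `i` and `i + 1`. The component of the exchange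
equation at `e_i p` expresses the divided difference of `g_{e_i p}` by the components `g_Q` at the
patterns `Q` with the same cap. One of these is `p`; every other `Q` is the pattern `e_i p` or comes
from it by merging the arch with something next to it or turning it around the puncture, so that the
total length of its arcs is at least that of `e_i p`, which is larger than that of `p`
(`LinkPattern.IsValley.eq_or_totalLength_le`). So `g_p` is determined by components at longer
patterns, and stays in `S`. A pattern without valleys is a rotation of the fully nested one
(`LinkPattern.exists_eq_translate_fullyNested`).

The cyclic equation supplies the rotations. In `V_n` it says that `g_{ρ L}` is a multiple of the
shifted `g_L`. In the restriction of `V_{n+1}` this remains true if `L` has no arch from `n` to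
`n + 1`, which covers what is needed to get from the fully nested pattern to all its rotations, and
to move a valley at `n + 1` to `n`. There is no exchange equation for a valley `p` at `n`, but the
component of the cyclic equation at `ρ e_n p` is a substitute: it contains `e_n`, and hence `g_p`
next to components at longer patterns. `LinkPattern.forall_of_cap_of_rotate` is the resulting
induction, common to both modules.
-/

namespace LinkPattern

/-! ### Lengths of arcs -/

theorem arc_lt {N : ℕ} [NeZero N] (L : LinkPattern N) (x : ℤ) : L.m x < x + N := by
  have hN : (0 : ℤ) < N := by exact_mod_cast NeZero.pos N
  by_contra! h
  rcases h.eq_or_lt with h | h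
  · have := L.fix_of_modEq (p := x) (by rw [← h]; simp [Int.ModEq])
    omega
  · have := L.noncrossing x (x + N) (by omega) h
    rw [L.periodic] at this
    omega

theorem lt_arc {N : ℕ} [NeZero N] (L : LinkPattern N) (x : ℤ) : x - N < L.m x := by
  have := L.arc_lt (L.m x)
  rw [L.invol] at this
  omega

theorem m_add_sub {N : ℕ} (L : LinkPattern N) {x y : ℤ} (h : (x : ZMod N) = y) :
    L.m y = L.m x + (y - x) := by
  have := L.period ((ZMod.intCast_eq_intCast_iff _ _ _).1 h) x
  rwa [show x + (y - x) = y by ring] at this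

theorem m_cast {N : ℕ} (L : LinkPattern N) {x y : ℤ} (h : (x : ZMod N) = y) :
    (L.m x : ZMod N) = L.m y := by
  rw [L.m_add_sub h]; push_cast; rw [h]; ring

/-- The length in the universal cover of the arc ending at a marked point. It is `0` for the
defect. -/
def arcLength {N : ℕ} (L : LinkPattern N) (a : ZMod N) : ℤ := |L.m a.cast - a.cast|

theorem arcLength_coe {N : ℕ} (L : LinkPattern N) (x : ℤ) :
    L.arcLength (x : ZMod N) = |L.m x - x| := by
  have h : (x : ZMod N) = (((x : ZMod N).cast : ℤ) : ZMod N) := by simp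
  rw [arcLength, L.m_add_sub h]
  congr 1; ring

/-- Twice the total length in the universal cover of the arcs of a pattern. -/
def totalLength {N : ℕ} [NeZero N] (L : LinkPattern N) : ℤ := ∑ a : ZMod N, L.arcLength a

theorem totalLength_le {N : ℕ} [NeZero N] (L : LinkPattern N) : L.totalLength ≤ N * N := by
  calc L.totalLength ≤ ∑ _a : ZMod N, (N : ℤ) := Finset.sum_le_sum fun a _ => by
        have h1 := L.arc_lt a.cast
        have h2 := L.lt_arc a.cast
        exact abs_le.2 ⟨by omega, by omega⟩
    _ = N * N := by simp [ZMod.card]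

theorem totalLength_sub {N : ℕ} [NeZero N] (L Q : LinkPattern N) (T : Finset (ZMod N))
    (h : ∀ x : ℤ, (x : ZMod N) ∉ T → L.m x = Q.m x) :
    L.totalLength - Q.totalLength = ∑ a ∈ T, (L.arcLength a - Q.arcLength a) := by
  rw [totalLength, totalLength, ← Finset.sum_sub_distrib]
  refine (Finset.sum_subset (Finset.subset_univ T) fun a _ ha => ?_).symm
  have : a = ((a.cast : ℤ) : ZMod N) := by simp
  rw [this, arcLength_coe, arcLength_coe, h _ (by rwa [← this])]
  ring

/-! ### Rotations -/

/-- The rotation of a pattern by `j` steps, for any integer `j`. -/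
def translate {N : ℕ} (L : LinkPattern N) (j : ℤ) : LinkPattern N where
  m x := L.m (x - j) + j
  invol x := by simp [L.invol]
  periodic x := by
    rw [show x + (N : ℤ) - j = x - j + N by ring, L.periodic]; ring
  noncrossing x y h1 h2 := by
    have := L.noncrossing (x - j) (y - j) (by omega) (by omega)
    omega
  defect x y hx hy := by
    have := L.defect (x - j) (y - j) (by omega) (by omega)
    simpa using this.add_right j

theorem rotate_translate {N : ℕ} (L : LinkPattern N) (j : ℤ) :
    (L.translate j).rotate = L.translate (j + 1) := by
  ext x
  simp only [rotate, translate]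
  rw [show x - 1 - j = x - (j + 1) by ring]; ring

theorem translate_zero {N : ℕ} (L : LinkPattern N) : L.translate 0 = L := by
  ext x; simp [translate]

theorem translate_eq_of_modEq {N : ℕ} (L : LinkPattern N) {j k : ℤ} (h : j ≡ k [ZMOD N]) :
    L.translate j = L.translate k := by
  ext x
  have := L.period h (x - k)
  simp only [translate]
  rw [show x - k + (k - j) = x - j by ring] at this
  rw [this]; ring

theorem rotate_injective {N : ℕ} : Function.Injective (rotate : LinkPattern N → LinkPattern N) := by
  intro L Q h
  ext x
  have := congrArg (fun R : LinkPattern N => R.m (x + 1)) h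
  simpa [rotate] using this

theorem totalLength_rotate {N : ℕ} [NeZero N] (L : LinkPattern N) :
    L.rotate.totalLength = L.totalLength := by
  rw [totalLength, totalLength, ← Equiv.sum_comp (Equiv.addRight (1 : ZMod N))]
  refine Finset.sum_congr rfl fun a _ => ?_
  have h : a = ((a.cast : ℤ) : ZMod N) := by simp
  have h' : Equiv.addRight (1 : ZMod N) a = ((a.cast + 1 : ℤ) : ZMod N) := by simp
  rw [h', arcLength_coe]
  nth_rw 3 [h]
  rw [arcLength_coe]
  simp [rotate]

/-! ### Patterns with the same cap -/

/-- If neither of the strands at `i` and `i + 1` is the defect and `i`, `i + 1` are not joined to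
each other (in either way around the puncture), then `i`, `i + 1` and the other ends of their arcs
are four different marked points. -/
theorem four_distinct {N : ℕ} [NeZero N] (hN : 2 ≤ N) (Q : LinkPattern N) (i : ℤ) (h1 : Q.m i ≠ i)
    (h2 : Q.m (i + 1) ≠ i + 1) (h3 : Q.m i ≠ i + 1) (h4 : Q.m (i + 1) ≠ i + N) :
    ((i : ℤ) : ZMod N) ≠ ((i + 1 : ℤ) : ZMod N) ∧ (Q.m i : ZMod N) ≠ ((i : ℤ) : ZMod N) ∧
    (Q.m i : ZMod N) ≠ ((i + 1 : ℤ) : ZMod N) ∧ (Q.m (i + 1) : ZMod N) ≠ ((i : ℤ) : ZMod N) ∧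
    (Q.m (i + 1) : ZMod N) ≠ ((i + 1 : ℤ) : ZMod N) ∧
    (Q.m i : ZMod N) ≠ (Q.m (i + 1) : ZMod N) := by
  have e1 : ((i : ℤ) : ZMod N) ≠ ((i + 1 : ℤ) : ZMod N) := fun h =>
    not_modEq_succ hN i ((ZMod.intCast_eq_intCast_iff _ _ _).1 h.symm)
  have e2 : (Q.m i : ZMod N) ≠ ((i : ℤ) : ZMod N) := fun h =>
    h1 (Q.fix_of_modEq ((ZMod.intCast_eq_intCast_iff _ _ _).1 h.symm))
  have e3 : (Q.m (i + 1) : ZMod N) ≠ ((i + 1 : ℤ) : ZMod N) := fun h =>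
    h2 (Q.fix_of_modEq ((ZMod.intCast_eq_intCast_iff _ _ _).1 h.symm))
  have e4 : (Q.m i : ZMod N) ≠ ((i + 1 : ℤ) : ZMod N) := by
    intro h
    have a1 := Q.m_add_sub h
    rw [Q.invol] at a1
    have a2 := Q.arc_lt i
    have a3 := Q.lt_arc i
    obtain ⟨k, hk⟩ := ((ZMod.intCast_eq_intCast_iff _ _ _).1 h).dvd
    have hN' : (2 : ℤ) ≤ N := by exact_mod_cast hN
    have k1 : k < 2 := by nlinarith
    have k2 : -1 < k := by nlinarith
    obtain rfl | rfl : k = 0 ∨ k = 1 := by omega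
    · omega
    · omega
  refine ⟨e1, e2, e4, fun h => e4 ?_, e3, fun h => e1 ?_⟩
  · have := Q.m_cast h
    rw [Q.invol] at this
    exact this.symm
  · have := Q.m_cast h
    rwa [Q.invol, Q.invol] at this

theorem cap_m {N : ℕ} (hN : 2 ≤ N) (Q : LinkPattern N) (i x : ℤ) :
    (Q.cap i).m x = Q.capFun i x := by simp [cap, hN]

theorem cap_m_self {N : ℕ} (hN : 2 ≤ N) (Q : LinkPattern N) (i : ℤ) : (Q.cap i).m i = i + 1 := by
  rw [cap_m hN, Q.capFun_of_left rfl]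

theorem cap_m_succ {N : ℕ} (hN : 2 ≤ N) (Q : LinkPattern N) (i : ℤ) : (Q.cap i).m (i + 1) = i := by
  rw [cap_m hN, Q.capFun_of_right hN (by simp)]; ring

/-- Outside the marked points `i`, `i + 1` and the other ends of their arcs, `e_i` changes
nothing. -/
theorem cap_m_of_ne {N : ℕ} (hN : 2 ≤ N) (Q : LinkPattern N) (i x : ℤ)
    (h1 : (x : ZMod N) ≠ ((i : ℤ) : ZMod N)) (h2 : (x : ZMod N) ≠ ((i + 1 : ℤ) : ZMod N))
    (h3 : (x : ZMod N) ≠ (Q.m i : ZMod N)) (h4 : (x : ZMod N) ≠ (Q.m (i + 1) : ZMod N)) :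
    (Q.cap i).m x = Q.m x := by
  have a1 : ¬ x ≡ i [ZMOD N] := fun h => h1 ((ZMod.intCast_eq_intCast_iff _ _ _).2 h)
  have a2 : ¬ x ≡ i + 1 [ZMOD N] := fun h => h2 ((ZMod.intCast_eq_intCast_iff _ _ _).2 h)
  have a3 : ¬ Q.m x ≡ i [ZMOD N] := fun h => h3 <| by
    have := Q.m_cast ((ZMod.intCast_eq_intCast_iff _ _ _).2 h)
    rwa [Q.invol] at this
  have a4 : ¬ Q.m x ≡ i + 1 [ZMOD N] := fun h => h4 <| by
    have := Q.m_cast ((ZMod.intCast_eq_intCast_iff _ _ _).2 h)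
    rwa [Q.invol] at this
  rw [cap_m hN, capFun, if_neg a1, if_neg a2, if_neg a3, if_neg a4]

theorem cap_m_left {N : ℕ} [NeZero N] (hN : 2 ≤ N) (Q : LinkPattern N) (i : ℤ) (h1 : Q.m i ≠ i)
    (h2 : Q.m (i + 1) ≠ i + 1) (h3 : Q.m i ≠ i + 1) (h4 : Q.m (i + 1) ≠ i + N) :
    (Q.cap i).m (Q.m i) = Q.m (i + 1) := by
  obtain ⟨-, e2, e3, -⟩ := Q.four_distinct hN i h1 h2 h3 h4
  have a1 : ¬ Q.m i ≡ i [ZMOD N] := fun h => e2 ((ZMod.intCast_eq_intCast_iff _ _ _).2 h)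
  have a2 : ¬ Q.m i ≡ i + 1 [ZMOD N] := fun h => e3 ((ZMod.intCast_eq_intCast_iff _ _ _).2 h)
  rw [cap_m hN, capFun, if_neg a1, if_neg a2, Q.invol, if_pos (Int.ModEq.refl _), if_neg h2]

theorem totalLength_cap {N : ℕ} [NeZero N] (hN : 2 ≤ N) (Q : LinkPattern N) (i : ℤ) (h1 : Q.m i ≠ i)
    (h2 : Q.m (i + 1) ≠ i + 1) (h3 : Q.m i ≠ i + 1) (h4 : Q.m (i + 1) ≠ i + N) :
    (Q.cap i).totalLength - Q.totalLength =
      2 * (1 + |Q.m (i + 1) - Q.m i| - |Q.m i - i| - |Q.m (i + 1) - (i + 1)|) := by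
  obtain ⟨e1, e2, e3, e4, e5, e6⟩ := Q.four_distinct hN i h1 h2 h3 h4
  have c1 := Q.cap_m_left hN i h1 h2 h3 h4
  have c2 : (Q.cap i).m (Q.m (i + 1)) = Q.m i := by rw [← c1, invol]
  rw [totalLength_sub (Q.cap i) Q {((i : ℤ) : ZMod N), ((i + 1 : ℤ) : ZMod N), (Q.m i : ZMod N),
    (Q.m (i + 1) : ZMod N)} fun x hx => ?_]
  · rw [Finset.sum_insert (by simp only [Finset.mem_insert, Finset.mem_singleton, not_or]
                              exact ⟨e1, e2.symm, e4.symm⟩),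
      Finset.sum_insert (by simp only [Finset.mem_insert, Finset.mem_singleton, not_or]
                            exact ⟨e3.symm, e5.symm⟩),
      Finset.sum_insert (by simpa using e6), Finset.sum_singleton]
    simp only [arcLength_coe, c1, c2, cap_m_self hN, cap_m_succ hN, invol]
    rw [abs_sub_comm (Q.m i) (Q.m (i + 1)), abs_sub_comm i (Q.m i),
      abs_sub_comm (i + 1) (Q.m (i + 1)), abs_sub_comm i (i + 1)]
    simp only [add_sub_cancel_left, abs_one]
    ring
  · simp only [Finset.mem_insert, Finset.mem_singleton, not_or] at hx
    exact Q.cap_m_of_ne hN i x hx.1 hx.2.1 hx.2.2.1 hx.2.2.2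

theorem cap_eq_self {N : ℕ} [NeZero N] (hN : 2 ≤ N) (Q : LinkPattern N) (i : ℤ)
    (h : Q.m i = i + 1) : Q.cap i = Q := by
  have h' : Q.m (i + 1) = i := by rw [← h, invol]
  ext x
  by_cases h1 : ((i : ℤ) : ZMod N) = x
  · rw [(Q.cap i).m_add_sub h1, Q.m_add_sub h1, cap_m_self hN, h]
  by_cases h2 : ((i + 1 : ℤ) : ZMod N) = x
  · rw [(Q.cap i).m_add_sub h2, Q.m_add_sub h2, cap_m_succ hN, h']
  exact Q.cap_m_of_ne hN i x (Ne.symm h1) (Ne.symm h2) (by rw [h]; exact Ne.symm h2)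
    (by rw [h']; exact Ne.symm h1)

theorem totalLength_cap_of_fix_left {N : ℕ} [NeZero N] (hN : 2 ≤ N) (Q : LinkPattern N) (i : ℤ)
    (h : Q.m i = i) : (Q.cap i).totalLength ≤ Q.totalLength := by
  have n1 : ((i : ℤ) : ZMod N) ≠ ((i + 1 : ℤ) : ZMod N) := fun h =>
    not_modEq_succ hN i ((ZMod.intCast_eq_intCast_iff _ _ _).1 h.symm)
  have h0 : Q.m (i + 1) ≠ i + 1 := fun h' =>
    n1 ((ZMod.intCast_eq_intCast_iff _ _ _).2 (Q.defect _ _ h h'))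
  have e1 : (Q.m (i + 1) : ZMod N) ≠ ((i + 1 : ℤ) : ZMod N) := fun h =>
    h0 (Q.fix_of_modEq ((ZMod.intCast_eq_intCast_iff _ _ _).1 h.symm))
  have e2 : (Q.m (i + 1) : ZMod N) ≠ ((i : ℤ) : ZMod N) := fun h' => n1 <| by
    have := Q.m_cast h'
    rw [invol, h] at this
    exact this.symm
  have c : (Q.cap i).m (Q.m (i + 1)) = Q.m (i + 1) := by
    have a1 : ¬ Q.m (i + 1) ≡ i [ZMOD N] := fun h => e2 ((ZMod.intCast_eq_intCast_iff _ _ _).2 h)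
    have a2 : ¬ Q.m (i + 1) ≡ i + 1 [ZMOD N] :=
      fun h => e1 ((ZMod.intCast_eq_intCast_iff _ _ _).2 h)
    have a3 : ¬ i + 1 ≡ i [ZMOD N] := not_modEq_succ hN i
    rw [cap_m hN, capFun, if_neg a1, if_neg a2, Q.invol, if_neg a3, if_pos (Int.ModEq.refl _), if_pos (by simpa)]
  have key := totalLength_sub (Q.cap i) Q {((i : ℤ) : ZMod N), ((i + 1 : ℤ) : ZMod N),
    (Q.m (i + 1) : ZMod N)} fun x hx => by
      simp only [Finset.mem_insert, Finset.mem_singleton, not_or] at hx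
      exact Q.cap_m_of_ne hN i x hx.1 hx.2.1 (by rw [h]; exact hx.1) hx.2.2
  rw [Finset.sum_insert (by simp only [Finset.mem_insert, Finset.mem_singleton, not_or]
                            exact ⟨n1, e2.symm⟩),
      Finset.sum_insert (by simpa using e1.symm), Finset.sum_singleton] at key
  simp only [arcLength_coe, c, cap_m_self hN, cap_m_succ hN, invol, h] at key
  grind

theorem totalLength_cap_of_fix_right {N : ℕ} [NeZero N] (hN : 2 ≤ N) (Q : LinkPattern N) (i : ℤ)
    (h : Q.m (i + 1) = i + 1) : (Q.cap i).totalLength ≤ Q.totalLength := by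
  have n1 : ((i : ℤ) : ZMod N) ≠ ((i + 1 : ℤ) : ZMod N) := fun h =>
    not_modEq_succ hN i ((ZMod.intCast_eq_intCast_iff _ _ _).1 h.symm)
  have h0 : Q.m i ≠ i := fun h' =>
    n1 ((ZMod.intCast_eq_intCast_iff _ _ _).2 (Q.defect _ _ h' h))
  have e1 : (Q.m i : ZMod N) ≠ ((i : ℤ) : ZMod N) := fun h =>
    h0 (Q.fix_of_modEq ((ZMod.intCast_eq_intCast_iff _ _ _).1 h.symm))
  have e2 : (Q.m i : ZMod N) ≠ ((i + 1 : ℤ) : ZMod N) := fun h' => n1 <| by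
    have := Q.m_cast h'
    rw [invol, h] at this
    exact this
  have c : (Q.cap i).m (Q.m i) = Q.m i := by
    have a1 : ¬ Q.m i ≡ i [ZMOD N] := fun h => e1 ((ZMod.intCast_eq_intCast_iff _ _ _).2 h)
    have a2 : ¬ Q.m i ≡ i + 1 [ZMOD N] := fun h => e2 ((ZMod.intCast_eq_intCast_iff _ _ _).2 h)
    rw [cap_m hN, capFun, if_neg a1, if_neg a2, Q.invol, if_pos (Int.ModEq.refl _), if_pos h]
  have key := totalLength_sub (Q.cap i) Q {((i : ℤ) : ZMod N), ((i + 1 : ℤ) : ZMod N),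
    (Q.m i : ZMod N)} fun x hx => by
      simp only [Finset.mem_insert, Finset.mem_singleton, not_or] at hx
      exact Q.cap_m_of_ne hN i x hx.1 hx.2.1 hx.2.2 (by rw [h]; exact hx.2.1)
  rw [Finset.sum_insert (by simp only [Finset.mem_insert, Finset.mem_singleton, not_or]
                            exact ⟨n1, e1.symm⟩),
      Finset.sum_insert (by simpa using e2.symm), Finset.sum_singleton] at key
  simp only [arcLength_coe, c, cap_m_self hN, cap_m_succ hN, invol, h] at key
  grind

theorem totalLength_cap_of_loop {N : ℕ} [NeZero N] (hN : 2 ≤ N) (Q : LinkPattern N) (i : ℤ)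
    (h : Q.m (i + 1) = i + N) : (Q.cap i).totalLength ≤ Q.totalLength := by
  have n1 : ((i : ℤ) : ZMod N) ≠ ((i + 1 : ℤ) : ZMod N) := fun h =>
    not_modEq_succ hN i ((ZMod.intCast_eq_intCast_iff _ _ _).1 h.symm)
  have h' : Q.m i = i + 1 - N := by
    have h1 := Q.periodic i
    rw [← h, invol] at h1
    omega
  have key := totalLength_sub (Q.cap i) Q {((i : ℤ) : ZMod N), ((i + 1 : ℤ) : ZMod N)}
    fun x hx => by
      simp only [Finset.mem_insert, Finset.mem_singleton, not_or] at hx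
      exact Q.cap_m_of_ne hN i x hx.1 hx.2 (by rw [h']; simpa using hx.2)
        (by rw [h]; simpa using hx.1)
  rw [Finset.sum_insert (by simpa using n1), Finset.sum_singleton] at key
  simp only [arcLength_coe, cap_m_self hN, cap_m_succ hN, h, h'] at key
  grind

/-- A valley of `p`: the arcs ending at `i` and `i + 1` lie on different sides, and they are not
one arc that goes around the puncture. -/
structure IsValley {N : ℕ} (p : LinkPattern N) (i : ℤ) : Prop where
  left : p.m i < i
  right : i + 1 < p.m (i + 1)
  not_loop : p.m (i + 1) ≠ i + N

theorem IsValley.two_le {N : ℕ} [NeZero N] {p : LinkPattern N} {i : ℤ} (h : p.IsValley i) :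
    2 ≤ N := by
  have := p.lt_arc i
  have := h.left
  omega

theorem IsValley.totalLength_lt {N : ℕ} [NeZero N] {p : LinkPattern N} {i : ℤ}
    (h : p.IsValley i) : p.totalLength < (p.cap i).totalLength := by
  have h1 := h.left
  have h2 := h.right
  have := p.totalLength_cap h.two_le i (by omega) (by omega) (by omega) h.not_loop
  grind

/-- The arc of `p.cap i` around the arch at a valley `i` of `p` is the innermost one, so it is
determined by `p.cap i`. -/
theorem IsValley.m_le {N : ℕ} [NeZero N] {p Q : LinkPattern N} {i : ℤ} (h : p.IsValley i)
    (hQ : Q.IsValley i) (hcap : Q.cap i = p.cap i) : Q.m i ≤ p.m i := by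
  have hN := h.two_le
  have h1 := h.left
  have h2 := h.right
  have h3 := hQ.left
  have h4 := hQ.right
  by_contra! hlt
  have hin := p.noncrossing (p.m i) (Q.m i) hlt (by rw [invol]; exact h3)
  rw [invol] at hin
  have hc := Q.cap_m_left hN i (by omega) (by omega) (by omega) hQ.not_loop
  obtain ⟨-, d2, d3, -⟩ := Q.four_distinct hN i (by omega) (by omega) (by omega) hQ.not_loop
  rw [hcap, cap_m hN] at hc
  rcases p.capFun_cases hN i (Q.m i) with ⟨e, -⟩ | ⟨e, -⟩ | ⟨-, -, ⟨q, hq, e1, e2, -⟩ |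
    ⟨q, hq, e1, e2, e3⟩ | ⟨-, -, e⟩⟩
  · exact d2 ((ZMod.intCast_eq_intCast_iff _ _ _).2 e)
  · exact d3 ((ZMod.intCast_eq_intCast_iff _ _ _).2 (modEq_sub_one.2 e))
  · have := p.m_add_sub ((ZMod.intCast_eq_intCast_iff _ _ _).2 hq)
    omega
  · have := p.m_add_sub ((ZMod.intCast_eq_intCast_iff _ _ _).2 hq)
    omega
  · omega

/-- The patterns with the same cap at `i` as a pattern `p` with valley `i` are `p` and patterns
that are longer than `p`: the arch at `i` can be merged with the arc around it, which gives `p`, or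
with an arc (or the defect) next to it, or it can be turned around the puncture. -/
theorem IsValley.eq_or_totalLength_le {N : ℕ} [NeZero N] {p Q : LinkPattern N} {i : ℤ}
    (h : p.IsValley i) (hcap : Q.cap i = p.cap i) :
    Q = p ∨ (p.cap i).totalLength ≤ Q.totalLength := by
  have hN := h.two_le
  by_cases h1 : Q.m i = i
  · exact Or.inr (hcap ▸ Q.totalLength_cap_of_fix_left hN i h1)
  by_cases h2 : Q.m (i + 1) = i + 1
  · exact Or.inr (hcap ▸ Q.totalLength_cap_of_fix_right hN i h2)
  by_cases h3 : Q.m i = i + 1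
  · exact Or.inr (by rw [← hcap, Q.cap_eq_self hN i h3])
  by_cases h4 : Q.m (i + 1) = i + N
  · exact Or.inr (hcap ▸ Q.totalLength_cap_of_loop hN i h4)
  have hlen := Q.totalLength_cap hN i h1 h2 h3 h4
  rw [hcap] at hlen
  have h3' : Q.m (i + 1) ≠ i := fun e => h3 (by rw [← Q.invol (i + 1), e])
  have n1 := Q.noncrossing i (i + 1)
  have n2 := Q.noncrossing (Q.m (i + 1)) i
  rw [invol] at n2
  by_cases hv : Q.m i < i ∧ i + 1 < Q.m (i + 1)
  · left
    have hQ : Q.IsValley i := ⟨hv.1, hv.2, h4⟩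
    have ea : Q.m i = p.m i := le_antisymm (h.m_le hQ hcap) (hQ.m_le h hcap.symm)
    have hl := h.left
    have hr := h.right
    have eb : Q.m (i + 1) = p.m (i + 1) := by
      rw [← Q.cap_m_left hN i h1 h2 h3 h4, hcap, ea,
        p.cap_m_left hN i (by omega) (by omega) (by omega) h.not_loop]
    ext x
    by_cases x1 : ((i : ℤ) : ZMod N) = x
    · rw [Q.m_add_sub x1, p.m_add_sub x1, ea]
    by_cases x2 : ((i + 1 : ℤ) : ZMod N) = x
    · rw [Q.m_add_sub x2, p.m_add_sub x2, eb]
    by_cases x3 : (p.m i : ZMod N) = x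
    · rw [Q.m_add_sub x3, p.m_add_sub x3, invol, ← ea, invol]
    by_cases x4 : (p.m (i + 1) : ZMod N) = x
    · rw [Q.m_add_sub x4, p.m_add_sub x4, invol, ← eb, invol]
    rw [← Q.cap_m_of_ne hN i x (Ne.symm x1) (Ne.symm x2) (ea ▸ Ne.symm x3) (eb ▸ Ne.symm x4), hcap,
      p.cap_m_of_ne hN i x (Ne.symm x1) (Ne.symm x2) (Ne.symm x3) (Ne.symm x4)]
  · right
    -- The partners of `i` and `i + 1` are on the same side of the two points, so in `Q` two nested
    -- arcs replace the arch and a neighbouring arc of the cap; `hlen` compares the lengths.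
    grind

theorem IsValley.loopWeight {N : ℕ} {p : LinkPattern N} {i : ℤ}
    (h : p.IsValley i) (τ : ℂˣ) : p.loopWeight τ i = 1 := by
  have := h.left
  rw [LinkPattern.loopWeight, if_neg (by omega), if_neg h.not_loop]

theorem IsValley.translate {N : ℕ} {p : LinkPattern N} {i : ℤ} (h : p.IsValley i) (j : ℤ) :
    (p.translate j).IsValley (i + j) := by
  have h1 := h.left
  have h2 := h.right
  have h3 := h.not_loop
  refine ⟨?_, ?_, ?_⟩ <;> simp only [LinkPattern.translate] <;>
    simp only [show i + j + 1 - j = i + 1 by ring, show i + j - j = i by ring] <;> omega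

/-! ### Patterns without valleys -/

/-- If the arcs ending in the interval `[l, l + k)` stay inside and there is no valley inside, then
these arcs are nested. -/
theorem eq_reflection_of_no_valley {N : ℕ} (p : LinkPattern N) (k : ℕ) (l : ℤ)
    (hin : ∀ x, l ≤ x → x < l + k → l ≤ p.m x ∧ p.m x < l + k ∧ p.m x ≠ x)
    (hv : ∀ i, l ≤ i → i + 1 < l + k → p.m i < i → p.m (i + 1) < i + 1) :
    ∀ x, l ≤ x → x < l + k → p.m x = 2 * l + k - 1 - x := by
  induction k using Nat.strong_induction_on generalizing l with
  | _ k ih =>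
  intro x hx hx'
  have hl := hin l le_rfl (by omega)
  -- If the arc from `l` ended before the right end of the interval, its end would be a valley.
  have e : p.m l = l + k - 1 := by
    by_contra hne
    have h1 := hin (p.m l + 1) (by omega) (by omega)
    have h2 := hv (p.m l) (by omega) (by omega) (by rw [invol]; omega)
    have h3 := p.noncrossing (p.m (p.m l + 1)) (p.m l) 
    have h4 := p.noncrossing l (p.m (p.m l + 1))
    rw [invol] at h3 h4
    have h5 : p.m (p.m l + 1) ≠ l := fun h => by
      have := congrArg p.m h
      rw [invol] at this
      omega
    have h6 : p.m (p.m l + 1) ≠ p.m l := fun h => by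
      have := congrArg p.m h
      rw [invol, invol] at this
      omega
    omega
  have e' : p.m (l + k - 1) = l := by rw [← e, invol]
  rcases eq_or_ne x l with rfl | hxl
  · omega
  rcases eq_or_ne x (l + k - 1) with rfl | hxr
  · omega
  have hk : ((k - 2 : ℕ) : ℤ) = k - 2 := by omega
  have := ih (k - 2) (by omega) (l + 1) (fun y hy hy' => by
      have h1 := hin y (by omega) (by omega)
      have h2 : p.m y ≠ l := fun h => by
        have := p.invol y
        rw [h] at this
        omega
      have h3 : p.m y ≠ l + k - 1 := fun h => by
        have := p.invol y
        rw [h] at this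
        omega
      omega)
    (fun i hi hi' => hv i (by omega) (by omega)) x (by omega) (by omega)
  omega

/-- A pattern without defect has a point where the arcs on the left and on the right go to
different sides. -/
theorem exists_lt_and_lt {N : ℕ} [NeZero N] (p : LinkPattern N) (h : ∀ x, p.m x ≠ x) :
    ∃ i, p.m i < i ∧ i + 1 < p.m (i + 1) := by
  by_contra! hno
  have hN : (0 : ℤ) < N := by exact_mod_cast NeZero.pos N
  obtain ⟨x, hx⟩ : ∃ x, p.m x < x := by
    rcases lt_or_gt_of_ne (h 0) with h0 | h0
    · exact ⟨0, h0⟩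
    · exact ⟨p.m 0, by rwa [invol]⟩
  have hall : ∀ j : ℕ, p.m (x + j) < x + j := by
    intro j
    induction j with
    | zero => simpa using hx
    | succ j ih =>
      have h1 := hno (x + j) ih
      have h2 := h (x + j + 1)
      push_cast
      rw [← add_assoc]
      omega
  have h1 := p.lt_arc x
  have h2 := hall (p.m x + N - x).toNat
  rw [Int.toNat_of_nonneg (by omega), show x + (p.m x + N - x) = p.m x + N by ring, p.periodic,
    invol] at h2
  omega

theorem eq_of_eq_on {N : ℕ} [NeZero N] {p Q : LinkPattern N} (l : ℤ)
    (h : ∀ x, l ≤ x → x < l + N → p.m x = Q.m x) : p = Q := by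
  have hN : (0 : ℤ) < N := by exact_mod_cast NeZero.pos N
  ext x
  have h1 := Int.emod_add_mul_ediv (x - l) N
  have h2 := Int.emod_nonneg (x - l) hN.ne'
  have h3 := Int.emod_lt_of_pos (x - l) hN
  rw [show x = (l + (x - l) % N) + N * ((x - l) / N) by omega, periodic_mul, periodic_mul,
    h _ (by omega) (by omega)]

theorem fullyNested_m {N : ℕ} [NeZero N] (x : ℤ) (h1 : -(N - 1 - (N + 1) / 2) ≤ x)
    (h2 : x ≤ ((N : ℤ) + 1) / 2) : (fullyNested N).m x =
      if Odd N ∧ x = ((N : ℤ) + 1) / 2 then x else 1 - x := by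
  have := nestedFun_add N x 0 h1 h2
  simpa [fullyNested] using this

/-- The patterns without valleys are the rotations of the fully nested one. -/
theorem exists_eq_translate_fullyNested {N : ℕ} [NeZero N] (p : LinkPattern N)
    (h : ∀ i, ¬ p.IsValley i) : ∃ j, p = (fullyNested N).translate j := by
  have hN : (0 : ℤ) < N := by exact_mod_cast NeZero.pos N
  by_cases hd : ∃ d, p.m d = d
  · -- Between two consecutive lifts of the defect all arcs are nested.
    obtain ⟨d, hd⟩ := hd
    have hd' : p.m (d + N) = d + N := by rw [p.periodic, hd]
    have hk : ((N - 1 : ℕ) : ℤ) = N - 1 := by omega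
    have hin : ∀ x, d < x → x < d + N → d < p.m x ∧ p.m x < d + N ∧ p.m x ≠ x := by
      intro x h1 h2
      have a1 := p.noncrossing (p.m x) d
      have a2 := p.noncrossing x (d + N)
      rw [invol] at a1
      have a3 : p.m x ≠ d := fun e => by
        have := congrArg p.m e
        rw [invol] at this
        omega
      have a4 : p.m x ≠ d + N := fun e => by
        have := congrArg p.m e
        rw [invol] at this
        omega
      have a5 : p.m x ≠ x := fun e => by
        obtain ⟨k, hk⟩ := (p.defect d x hd e).dvd
        have k1 : 0 < k := by by_contra!; nlinarith
        nlinarith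
      omega
    have hm := p.eq_reflection_of_no_valley (N - 1) (d + 1)
      (fun x h1 h2 => by have := hin x (by omega) (by omega); omega)
      (fun i h1 h2 h3 => by
        by_contra! h4
        have a1 := hin (i + 1) (by omega) (by omega)
        exact h i ⟨h3, by omega, by omega⟩)
    rw [hk] at hm
    -- For even `N` the reflection would have a second fixed point half a period away.
    have hodd : Odd N := by
      rw [← Nat.not_even_iff_odd]
      rintro ⟨r, hr⟩
      have a1 := hm (d + r) (by omega) (by omega)
      have a2 := hin (d + r) (by omega) (by omega)
      omega
    obtain ⟨r, hr⟩ := id hodd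
    refine ⟨d + r, eq_of_eq_on (d + 1) fun x h1 h2 => ?_⟩
    simp only [LinkPattern.translate]
    rw [fullyNested_m _ (by omega) (by omega)]
    split_ifs with hx
    · rw [show x = d + N by omega, hd']; ring
    · have hx' : x ≠ d + N := fun e => hx ⟨hodd, by omega⟩
      rw [hm x (by omega) (by omega)]
      omega
  · -- Without a defect there is an arc from `i + 1` around the puncture to `i + N`, and the other
    -- arcs are nested inside.
    push Not at hd
    obtain ⟨i, hi, hi'⟩ := p.exists_lt_and_lt hd
    have hloop : p.m (i + 1) = i + N := by
      by_contra hne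
      exact h i ⟨hi, hi', hne⟩
    have hin : ∀ x, i + 1 ≤ x → x < i + 1 + N →
        i + 1 ≤ p.m x ∧ p.m x < i + 1 + N ∧ p.m x ≠ x := by
      intro x h1 h2
      have a1 := p.noncrossing (i + 1) x
      have a2 := hd x
      rcases eq_or_ne x (i + 1) with rfl | h3
      · omega
      rcases eq_or_ne x (i + N) with rfl | h4
      · rw [← hloop, invol]; omega
      omega
    have hm := p.eq_reflection_of_no_valley N (i + 1) hin
      (fun j h1 h2 h3 => by
        by_contra! h4
        have a1 := hin (j + 1) (by omega) (by omega)
        exact h j ⟨h3, by omega, by omega⟩)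
    -- For odd `N` the reflection would fix the midpoint.
    have heven : ¬ Odd N := by
      rintro ⟨r, hr⟩
      have a1 := hm (i + 1 + r) (by omega) (by omega)
      have a2 := hd (i + 1 + r)
      omega
    obtain ⟨r, hr⟩ := Nat.not_odd_iff_even.1 heven
    refine ⟨i + r, eq_of_eq_on (i + 1) fun x h1 h2 => ?_⟩
    simp only [LinkPattern.translate]
    rw [fullyNested_m _ (by omega) (by omega), hm x h1 h2, if_neg fun e => heven e.1]
    omega

/-! ### The induction over link patterns -/

/-- The only arch of the fully nested pattern joins `N` and `1`, so none of its first `N - 1`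
rotations has an arch from `N - 1` to `N`. -/
theorem translate_fullyNested_m_ne {N : ℕ} [NeZero N] (j : ℕ) (hj : j + 1 < N) :
    ((fullyNested N).translate j).m (N - 1) ≠ N := by
  obtain ⟨y, s, hy, h1, h2⟩ := nested_decomp N ((N : ℤ) - 1 - j)
  have hN : (0 : ℤ) < N := by exact_mod_cast NeZero.pos N
  have := nestedFun_add N y s h1 h2
  rw [← hy] at this
  simp only [translate, fullyNested, this]
  split_ifs
  · omega
  · intro h
    have hs : (N : ℤ) * s = N - 1 - j - y := by omega
    have hy0 : y = 0 := by omega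
    subst hy0
    have s1 : 0 < s := by by_contra!; nlinarith
    nlinarith

/-- A property of link patterns holds for all of them if it holds for the fully nested pattern, is
invariant under rotation of patterns without an arch from `N - 1` to `N`, and passes to a pattern
`p` with valley `i < N` from `e_i p`, its rotation, and all other patterns with the same cap. -/
theorem forall_of_cap_of_rotate {N : ℕ} [NeZero N] (K : LinkPattern N → Prop)
    (base : K (fullyNested N))
    (rot : ∀ L : LinkPattern N, L.m (N - 1) ≠ N → (K L.rotate ↔ K L))
    (step : ∀ (p : LinkPattern N) (i : ℕ), 0 < i → i < N → p.IsValley i → K (p.cap i) →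
      K (p.cap i).rotate → (∀ Q, Q.cap i = p.cap i → Q ≠ p → K Q) → K p)
    (L : LinkPattern N) : K L := by
  have hN : (0 : ℤ) < N := by exact_mod_cast NeZero.pos N
  have hnested : ∀ j : ℕ, j < N → K ((fullyNested N).translate j) := by
    intro j
    induction j with
    | zero => intro _; simpa [translate_zero] using base
    | succ j ih =>
      intro hj
      have := (rot _ (translate_fullyNested_m_ne j hj)).2 (ih (by omega))
      rw [rotate_translate] at this
      exact_mod_cast this
  induction hk : (N * N - L.totalLength).toNat using Nat.strong_induction_on generalizing L with
  | _ k ih =>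
  have hlong : ∀ Q : LinkPattern N, L.totalLength < Q.totalLength → K Q := fun Q hQ =>
    ih _ (by have := Q.totalLength_le; omega) Q rfl
  have hstep : ∀ (p : LinkPattern N) (i : ℕ), 0 < i → i < N → p.IsValley i →
      p.totalLength = L.totalLength → K p := by
    intro p i h1 h2 hv hp
    have hlt := hv.totalLength_lt
    refine step p i h1 h2 hv (hlong _ (by omega)) (hlong _ (by rw [totalLength_rotate]; omega)) ?_
    intro Q hQ hne
    have := (hv.eq_or_totalLength_le hQ).resolve_left hne
    exact hlong _ (by omega)
  by_cases hv : ∃ i, L.IsValley i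
  · obtain ⟨i, hi⟩ := hv
    have hN2 := hi.two_le
    -- Valleys come in periods; `r` is the residue of `i` in `[0, N)`.
    obtain ⟨r, hrN, hr⟩ : ∃ r : ℕ, r < N ∧ L.IsValley r := by
      refine ⟨(i % N).toNat, ?_, ?_⟩
      · have := Int.emod_lt_of_pos i hN
        omega
      · have h1 := hi.translate (-(N * (i / N)))
        rw [L.translate_eq_of_modEq (k := 0) (Int.modEq_iff_dvd.2 ⟨i / N, by ring⟩),
          translate_zero] at h1
        have h2 := Int.emod_add_mul_ediv i N
        have h3 := Int.emod_nonneg i hN.ne'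
        rwa [Int.toNat_of_nonneg h3, show i % N = i + -(N * (i / N)) by omega]
    rcases Nat.eq_zero_or_pos r with rfl | hr0
    · -- A valley at `0` is moved to `N - 1`, by a rotation that `rot` allows to undo.
      have hv' : (L.translate (-1)).IsValley ((N - 1 : ℕ) : ℤ) := by
        have h1 := hr.translate (N - 1 : ℤ)
        rw [L.translate_eq_of_modEq (k := -1) (Int.modEq_iff_dvd.2 ⟨-1, by ring⟩)] at h1
        rwa [show ((N - 1 : ℕ) : ℤ) = ((0 : ℕ) : ℤ) + (N - 1 : ℤ) by omega]
      have hrot : (L.translate (-1)).rotate = L := by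
        rw [rotate_translate]; exact L.translate_zero
      have h1 := hstep _ (N - 1) (by omega) (by omega) hv'
        (by rw [← totalLength_rotate, hrot])
      rw [← hrot]
      refine (rot _ ?_).2 h1
      have := hv'.left
      rw [show ((N - 1 : ℕ) : ℤ) = (N : ℤ) - 1 by omega] at this
      omega
    · exact hstep L r hr0 hrN hr rfl
  · push Not at hv
    obtain ⟨j, rfl⟩ := L.exists_eq_translate_fullyNested hv
    have h0 := Int.emod_nonneg j hN.ne'
    have h1 := hnested (j % N).toNat (by have := Int.emod_lt_of_pos j hN; omega)
    rwa [Int.toNat_of_nonneg h0, translate_eq_of_modEq _ (Int.mod_modEq j N)] at h1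

end LinkPattern

/-! ### Substitutions and divided differences -/

namespace RatFun

theorem algebraMap_injective (n : ℕ) :
    Function.Injective (algebraMap (MvPolynomial (Fin n) ℂ) (RatFun n)) :=
  IsFractionRing.injective _ _

theorem subst_algebraMap {n : ℕ} (π : Equiv.Perm (Fin n)) (w : Fin n → ℂˣ)
    (p : MvPolynomial (Fin n) ℂ) :
    subst π w (algebraMap _ (RatFun n) p) = algebraMap _ (RatFun n) (polySubst π w p) := by
  simp [subst]

theorem subst_symm_algebraMap {n : ℕ} (π : Equiv.Perm (Fin n)) (w : Fin n → ℂˣ)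
    (p : MvPolynomial (Fin n) ℂ) :
    (subst π w).symm (algebraMap _ (RatFun n) p) =
      algebraMap _ (RatFun n) ((polySubst π w).symm p) := by
  rw [RingEquiv.symm_apply_eq, subst_algebraMap, AlgEquiv.apply_symm_apply]

theorem polySubst_isHomogeneous {n : ℕ} (π : Equiv.Perm (Fin n)) (w : Fin n → ℂˣ) {d : ℕ}
    {p : MvPolynomial (Fin n) ℂ} (hp : p.IsHomogeneous d) :
    (polySubst π w p).IsHomogeneous d := by
  have h := hp.aeval (fun j => MvPolynomial.C (w j : ℂ) * MvPolynomial.X (π j))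
    (n := 1) fun j => MvPolynomial.isHomogeneous_C_mul_X _ _
  rwa [one_mul] at h

theorem polySubst_symm_isHomogeneous {n : ℕ} (π : Equiv.Perm (Fin n)) (w : Fin n → ℂˣ) {d : ℕ}
    {p : MvPolynomial (Fin n) ℂ} (hp : p.IsHomogeneous d) :
    ((polySubst π w).symm p).IsHomogeneous d := by
  have h := hp.aeval
    (fun j => MvPolynomial.C ((w (π.symm j))⁻¹ : ℂˣ).val * MvPolynomial.X (π.symm j))
    (n := 1) fun j => MvPolynomial.isHomogeneous_C_mul_X _ _
  rwa [one_mul] at h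

theorem isHomogeneousPoly_subst_iff {n : ℕ} (π : Equiv.Perm (Fin n)) (w : Fin n → ℂˣ) {d : ℕ}
    {f : RatFun n} : IsHomogeneousPoly (subst π w f) d ↔ IsHomogeneousPoly f d := by
  constructor
  · rintro ⟨p, hp, h⟩
    refine ⟨_, polySubst_symm_isHomogeneous π w hp, ?_⟩
    rw [← subst_symm_algebraMap, h, RingEquiv.symm_apply_apply]
  · rintro ⟨p, hp, rfl⟩
    exact ⟨_, polySubst_isHomogeneous π w hp, (subst_algebraMap π w p).symm⟩

theorem X_sub_X_dvd {n : ℕ} (i j : Fin n) (p : MvPolynomial (Fin n) ℂ) :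
    MvPolynomial.X j - MvPolynomial.X i ∣ p - polySubst (Equiv.swap i j) (fun _ => 1) p := by
  rw [← Ideal.mem_span_singleton, ← Ideal.Quotient.eq]
  set I := Ideal.span {(MvPolynomial.X j - MvPolynomial.X i : MvPolynomial (Fin n) ℂ)}
  -- Both sides are values of algebra maps to the quotient in which `X i = X j`.
  have hij : Ideal.Quotient.mkₐ ℂ I (MvPolynomial.X j) =
      Ideal.Quotient.mkₐ ℂ I (MvPolynomial.X i) :=
    Ideal.Quotient.eq.2 (Ideal.mem_span_singleton_self _)
  have : Ideal.Quotient.mkₐ ℂ I =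
      (Ideal.Quotient.mkₐ ℂ I).comp (polySubst (Equiv.swap i j) fun _ => 1).toAlgHom := by
    refine MvPolynomial.algHom_ext fun k => ?_
    have : polySubst (Equiv.swap i j) (fun _ => 1) (MvPolynomial.X k) =
        MvPolynomial.X (Equiv.swap i j k) := by simp [polySubst]
    change _ = Ideal.Quotient.mkₐ ℂ I (polySubst (Equiv.swap i j) (fun _ => 1) (MvPolynomial.X k))
    rw [this, Equiv.swap_apply_def]
    split_ifs with h1 h2
    · rw [h1, hij]
    · rw [h2, hij]
    · rfl
  exact congrArg (fun φ => φ p) this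

theorem isHomogeneous_of_mul {σ : Type*} {a b : MvPolynomial σ ℂ} {k d : ℕ}
    (ha : a.IsHomogeneous k) (ha0 : a ≠ 0) (h : (a * b).IsHomogeneous (k + d)) :
    b.IsHomogeneous d := by
  let _ : GradedAlgebra (MvPolynomial.homogeneousSubmodule σ ℂ) := MvPolynomial.gradedAlgebra
  have h1 := DirectSum.coe_decompose_mul_of_left_mem_of_le
    (MvPolynomial.homogeneousSubmodule σ ℂ) (b := b) (n := k + d) ha (Nat.le_add_right k d)
  rw [DirectSum.decompose_of_mem_same _ h, Nat.add_sub_cancel_left] at h1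
  rw [mul_left_cancel₀ ha0 h1]
  exact (DirectSum.decompose (MvPolynomial.homogeneousSubmodule σ ℂ) b d).2

theorem linear_ne_zero {n : ℕ} {i j : Fin n} (hij : i ≠ j) {a b : ℂ} (ha : a ≠ 0) :
    MvPolynomial.C a * MvPolynomial.X i - MvPolynomial.C b * MvPolynomial.X j ≠ 0 := by
  intro h
  have := congrArg (MvPolynomial.coeff (Finsupp.single i 1)) h
  simp [MvPolynomial.coeff_C_mul, MvPolynomial.coeff_X, Finsupp.single_left_inj, hij.symm] at this
  exact ha this

theorem algebraMap_linear {n : ℕ} (i j : Fin n) (a b : ℂ) :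
    algebraMap (MvPolynomial (Fin n) ℂ) (RatFun n)
      (MvPolynomial.C a * MvPolynomial.X i - MvPolynomial.C b * MvPolynomial.X j) =
    algebraMap ℂ (RatFun n) a * z i - algebraMap ℂ (RatFun n) b * z j := by
  rw [map_sub, map_mul, map_mul, ← MvPolynomial.algebraMap_eq,
    ← IsScalarTower.algebraMap_apply, ← IsScalarTower.algebraMap_apply]
  rfl

theorem linear_z_ne_zero {n : ℕ} {i j : Fin n} (hij : i ≠ j) {a b : ℂ} (ha : a ≠ 0) :
    algebraMap ℂ (RatFun n) a * z i - algebraMap ℂ (RatFun n) b * z j ≠ 0 := by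
  rw [← algebraMap_linear]
  exact (map_ne_zero_iff _ (algebraMap_injective n)).2 (linear_ne_zero hij ha)

theorem z_sub_z_ne_zero {n : ℕ} {i j : Fin n} (hij : i ≠ j) : z j - z i ≠ (0 : RatFun n) := by
  simpa using linear_z_ne_zero hij.symm (a := 1) (b := 1) one_ne_zero

theorem z_ne_zero {n : ℕ} (i : Fin n) : z i ≠ (0 : RatFun n) :=
  (map_ne_zero_iff _ (algebraMap_injective n)).2 (MvPolynomial.X_ne_zero i)

/-- A space of rational functions that is stable under the operations by which the qKZ equations
express some components of a solution through others. -/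
structure IsStable {n : ℕ} (τ q : ℂˣ) (S : Submodule ℂ (RatFun n)) : Prop where
  swap : ∀ (i j : Fin n) (f : RatFun n), swapVars i j f ∈ S ↔ f ∈ S
  divDiff : ∀ (i j : Fin n) (f : RatFun n), i ≠ j → f ∈ S →
    (algebraMap ℂ (RatFun n) ((τ : ℂ) ^ 2) * z i - algebraMap ℂ (RatFun n) ((τ : ℂ) ^ 2)⁻¹ * z j) /
      (z j - z i) * (f - swapVars i j f) ∈ S
  cycle : ∀ f : RatFun n, cycleVars q f ∈ S ↔ f ∈ S

theorem isStable_bot {n : ℕ} (τ q : ℂˣ) : IsStable τ q (⊥ : Submodule ℂ (RatFun n)) where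
  swap i j f := by simp
  divDiff i j f _ hf := by
    rw [Submodule.mem_bot] at hf ⊢
    simp [hf]
  cycle f := by simp

/-- The space of homogeneous polynomials of degree `d`, as a space of rational functions. -/
noncomputable def homogeneous (n d : ℕ) : Submodule ℂ (RatFun n) :=
  (MvPolynomial.homogeneousSubmodule (Fin n) ℂ d).map
    (IsScalarTower.toAlgHom ℂ (MvPolynomial (Fin n) ℂ) (RatFun n)).toLinearMap

theorem mem_homogeneous {n d : ℕ} {f : RatFun n} : f ∈ homogeneous n d ↔ IsHomogeneousPoly f d := by
  rfl

theorem isStable_homogeneous {n : ℕ} (τ q : ℂˣ) (d : ℕ) : IsStable τ q (homogeneous n d) where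
  swap i j f := isHomogeneousPoly_subst_iff _ _
  divDiff i j f hij hf := by
    obtain ⟨p, hp, rfl⟩ := mem_homogeneous.1 hf
    obtain ⟨r, hr⟩ := X_sub_X_dvd i j p
    set l : MvPolynomial (Fin n) ℂ := MvPolynomial.C ((τ : ℂ) ^ 2) * MvPolynomial.X i -
      MvPolynomial.C ((τ : ℂ) ^ 2)⁻¹ * MvPolynomial.X j with hl
    refine mem_homogeneous.2 ⟨l * r, ?_, ?_⟩
    · refine isHomogeneous_of_mul (a := MvPolynomial.X j - MvPolynomial.X i) (k := 1)
        ((MvPolynomial.isHomogeneous_X _ _).sub (MvPolynomial.isHomogeneous_X _ _)) ?_ ?_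
      · simpa using linear_ne_zero hij.symm (a := 1) (b := 1) one_ne_zero
      · rw [mul_left_comm, ← hr]
        exact ((MvPolynomial.isHomogeneous_C_mul_X _ _).sub
          (MvPolynomial.isHomogeneous_C_mul_X _ _)).mul
            (hp.sub (polySubst_isHomogeneous _ _ hp))
    · have hz : z j - z i ≠ (0 : RatFun n) := z_sub_z_ne_zero hij
      have h := congrArg (algebraMap (MvPolynomial (Fin n) ℂ) (RatFun n)) hr
      rw [map_sub, map_mul, map_sub, ← subst_algebraMap] at h
      rw [← algebraMap_linear, map_mul, swapVars, h]
      change _ = _ / (z j - z i) * ((z j - z i) * _)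
      rw [div_mul_eq_mul_div, mul_left_comm, mul_div_cancel_left₀ _ hz]
  cycle f := isHomogeneousPoly_subst_iff _ _

end RatFun

/-! ### Components of the qKZ equations -/

namespace LinkModule

theorem mapCoeff_apply {n N : ℕ} (σ : RatFun n ≃+* RatFun n) (g : LinkModule n N)
    (L : LinkPattern N) : mapCoeff σ g L = σ (g L) := rfl

theorem rho_apply_rotate {n N : ℕ} (h : LinkModule n N) (L : LinkPattern N) :
    rho n N h L.rotate = h L :=
  Finsupp.mapDomain_apply LinkPattern.rotate_injective h L

theorem e_apply {n N : ℕ} (τ : ℂˣ) (i : ℤ) (h : LinkModule n N) (L : LinkPattern N) :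
    e n N τ i h L = h.sum fun Q r =>
      r * Finsupp.single (Q.cap i) (algebraMap ℂ (RatFun n) (Q.loopWeight τ i)) L := by
  simp only [e, Finsupp.linearCombination_apply, Finsupp.sum, Finsupp.finsetSum_apply,
    Finsupp.smul_apply, smul_eq_mul]

theorem e_apply_eq_zero {n N : ℕ} (hN : 2 ≤ N) (τ : ℂˣ) (i : ℤ) (h : LinkModule n N)
    (L : LinkPattern N) (hL : L.m i ≠ i + 1) : e n N τ i h L = 0 := by
  rw [e_apply]
  refine Finset.sum_eq_zero fun Q _ => ?_
  dsimp only
  rw [Finsupp.single_eq_of_ne, mul_zero]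
  rintro rfl
  exact hL (Q.cap_m_self hN i)

/-- If the components of `h` at all other patterns with the same cap are in `S`, then the component
of `e_i h` at the cap of the valley `i` of `p` is the component of `h` at `p` up to `S`. -/
theorem e_apply_cap_mem_iff {n N : ℕ} {S : Submodule ℂ (RatFun n)} (τ : ℂˣ) {i : ℤ}
    {p : LinkPattern N} (hp : p.IsValley i) {h : LinkModule n N}
    (hS : ∀ Q, Q.cap i = p.cap i → Q ≠ p → h Q ∈ S) :
    e n N τ i h (p.cap i) ∈ S ↔ h p ∈ S := by
  classical
  have h1 : e n N τ i (h.erase p) (p.cap i) ∈ S := by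
    rw [e_apply]
    refine Submodule.sum_mem _ fun Q _ => ?_
    dsimp only
    by_cases hQ : Q = p
    · rw [hQ, Finsupp.erase_same, zero_mul]; exact zero_mem _
    by_cases hc : Q.cap i = p.cap i
    · rw [Finsupp.erase_ne hQ, hc, Finsupp.single_eq_same, mul_comm, ← Algebra.smul_def]
      exact S.smul_mem _ (hS Q hc hQ)
    · rw [Finsupp.single_eq_of_ne (Ne.symm hc), mul_zero]; exact zero_mem _
  have h2 : e n N τ i (Finsupp.single p (h p)) (p.cap i) = h p := by
    simp [e, hp.loopWeight τ]
  conv_lhs => rw [← Finsupp.erase_add_single p h, map_add, Finsupp.add_apply, h2]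
  exact S.add_mem_iff_right h1

variable {n N : ℕ} {τ q c : ℂˣ} {S : Submodule ℂ (RatFun n)}

/-- The component of the exchange equation at `e_i p` shows that `g_p` is in `S` if `g` is in `S` at
`e_i p` and all other patterns with the same cap. -/
theorem mem_of_exchange {P : Module.End (RatFun n) (LinkModule n N)} {g : LinkModule n N}
    (hg : IsTwistedSymmetric τ q c (e n N τ) P g) (hS : RatFun.IsStable τ q S) {i : ℕ}
    (hi0 : 0 < i) (hin : i < n) {p : LinkPattern N} (hp : p.IsValley i) (hcap : g (p.cap i) ∈ S)
    (hQ : ∀ Q, Q.cap i = p.cap i → Q ≠ p → g Q ∈ S) : g p ∈ S := by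
  obtain ⟨k, rfl⟩ : ∃ k, i = k + 1 := ⟨i - 1, by omega⟩
  have hex := DFunLike.congr_fun (hg.exchange k hin) (p.cap (k + 1 : ℕ))
  set z₁ : Fin n := ⟨k, Nat.lt_of_succ_lt hin⟩ with hz₁
  set z₂ : Fin n := ⟨k + 1, hin⟩ with hz₂
  have hne : z₁ ≠ z₂ := by simp [hz₁, hz₂]
  simp only [LinearMap.add_apply, LinearMap.smul_apply, Finsupp.add_apply, Finsupp.smul_apply,
    smul_eq_mul, Module.End.one_apply] at hex
  set h := mapCoeff (RatFun.swapVars z₁ z₂) g with hh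
  have hmem : ∀ Q, h Q ∈ S ↔ g Q ∈ S := fun Q => hS.swap z₁ z₂ (g Q)
  rw [← hmem, ← e_apply_cap_mem_iff τ hp fun Q h1 h2 => (hmem Q).2 (hQ Q h1 h2)]
  have hd := hS.divDiff z₁ z₂ _ hne hcap
  rw [← mapCoeff_apply, ← hh] at hd
  have hs := S.smul_mem ((τ : ℂ) ^ 2 + ((τ : ℂ) ^ 2)⁻¹) ((hmem _).2 hcap)
  rw [Algebra.smul_def, map_add] at hs
  have hsub := S.sub_mem hd hs
  have n1 : RatFun.z z₂ - RatFun.z z₁ ≠ 0 := RatFun.z_sub_z_ne_zero hne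
  have n2 := RatFun.z_ne_zero z₁
  have n3 := RatFun.linear_z_ne_zero hne (a := (τ : ℂ) ^ 2) (b := ((τ : ℂ) ^ 2)⁻¹) (by simp)
  rw [weightA, weightB] at hex
  simp only [Nat.cast_add, Nat.cast_one] at hex hsub ⊢
  generalize algebraMap ℂ (RatFun n) ((τ : ℂ) ^ 2) = A at *
  generalize algebraMap ℂ (RatFun n) (((τ : ℂ) ^ 2)⁻¹) = B at *
  generalize RatFun.z z₁ = x at *
  generalize RatFun.z z₂ = y at *
  have n4 : A - B * (y / x) ≠ 0 := by
    intro h0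
    apply n3
    field_simp at h0
    linear_combination h0
  -- The exchange equation, solved for the component of `e_i h`.
  have key : e n N τ (k + 1) h (p.cap (k + 1)) =
      (A * x - B * y) / (y - x) * (g (p.cap (k + 1)) - h (p.cap (k + 1))) -
        (A + B) * h (p.cap (k + 1)) := by
    rw [← hex]
    generalize e n N τ (k + 1) h (p.cap (k + 1)) = E
    generalize h (p.cap (k + 1)) = H
    have : A - B * (y / x) = (A * x - B * y) / x := by field_simp
    rw [this]
    field_simp
    ring
  rw [key]
  exact hsub

theorem smul_unit_mem_iff (u : ℂˣ) (f : RatFun n) : ((u : ℂ)⁻¹) • f ∈ S ↔ f ∈ S :=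
  S.smul_mem_iff (inv_ne_zero u.ne_zero)

theorem rhoRes_apply_rotate (h : LinkModule n (n + 1)) (L : LinkPattern (n + 1)) :
    rhoRes n τ h L.rotate = ((τ : ℂ)⁻¹) • e n (n + 1) τ n h L + (τ : ℂ) • h L := by
  rw [rhoRes, Module.End.mul_apply, rho_apply_rotate]
  rfl

theorem apply_mem_of_isSolution [NeZero n] {g : LinkModule n n} (hg : IsSolution n τ q c g)
    (hS : RatFun.IsStable τ q S) (h0 : g (LinkPattern.fullyNested n) ∈ S) (L : LinkPattern n) :
    g L ∈ S := by
  refine LinkPattern.forall_of_cap_of_rotate (fun L => g L ∈ S) h0 (fun L _ => ?_)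
    (fun p i hi0 hin hp h1 _ h2 => mem_of_exchange hg hS hi0 hin hp h1 h2) L
  have h := DFunLike.congr_fun hg.cyclic L.rotate
  rw [Finsupp.smul_apply, rho_apply_rotate, mapCoeff_apply] at h
  rw [← h, smul_unit_mem_iff, hS.cycle]

theorem apply_mem_of_isRestrictedSolution [NeZero n] {g : LinkModule n (n + 1)}
    (hg : IsRestrictedSolution n τ q c g) (hS : RatFun.IsStable τ q S)
    (h0 : g (LinkPattern.fullyNested (n + 1)) ∈ S) (L : LinkPattern (n + 1)) : g L ∈ S := by
  have hcyc : ∀ L : LinkPattern (n + 1), g L.rotate ∈ S ↔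
      ((τ : ℂ)⁻¹) • e n (n + 1) τ n (mapCoeff (RatFun.cycleVars q) g) L +
        (τ : ℂ) • mapCoeff (RatFun.cycleVars q) g L ∈ S := fun L => by
    have h := DFunLike.congr_fun hg.cyclic L.rotate
    rw [Finsupp.smul_apply, rhoRes_apply_rotate] at h
    rw [← h, smul_unit_mem_iff]
  have hmem : ∀ Q, mapCoeff (RatFun.cycleVars q) g Q ∈ S ↔ g Q ∈ S := fun Q => hS.cycle (g Q)
  have hn := NeZero.pos n
  refine LinkPattern.forall_of_cap_of_rotate (fun L => g L ∈ S) h0 (fun L hL => ?_)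
    (fun p i hi0 hin hp h1 h1' h2 => ?_) L
  · rw [hcyc, e_apply_eq_zero (by omega) _ _ _ _ (by push_cast at hL; simpa using hL), smul_zero,
      zero_add, S.smul_mem_iff τ.ne_zero, hmem]
  · rcases (Nat.lt_succ_iff.1 hin).lt_or_eq with hlt | rfl
    · exact mem_of_exchange hg hS hi0 hlt hp h1 h2
    · -- Read `h1'`, about the rotation of `p.cap n`, as a statement about `g p`.
      rwa [hcyc, S.add_mem_iff_left (S.smul_mem _ ((hmem _).2 h1)), smul_unit_mem_iff,
        e_apply_cap_mem_iff τ hp fun Q a b => (hmem Q).2 (h2 Q a b), hmem] at h1'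

end LinkModule

/-! ### The two modules -/

theorem mainTheorem5 (n : ℕ) [NeZero n] (τ q c : ℂˣ)
    (hτ : ((τ : ℂ) ^ 2 + 1) * ((τ : ℂ) ^ 4 + 1) ≠ 0) :
    (∀ g : LinkModule n n, IsSolution n τ q c g →
      (g (LinkPattern.fullyNested n) = 0 → g = 0) ∧
      (∀ d : ℕ, RatFun.IsHomogeneousPoly (g (LinkPattern.fullyNested n)) d →
        ∀ L : LinkPattern n, RatFun.IsHomogeneousPoly (g L) d)) ∧
    (∀ g : LinkModule n (n + 1), IsRestrictedSolution n τ q c g →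
      (g (LinkPattern.fullyNested (n + 1)) = 0 → g = 0) ∧
      (∀ d : ℕ, RatFun.IsHomogeneousPoly (g (LinkPattern.fullyNested (n + 1))) d →
        ∀ L : LinkPattern (n + 1), RatFun.IsHomogeneousPoly (g L) d)) := by
  refine ⟨fun g hg => ⟨fun h0 => ?_, fun d hd L => ?_⟩,
    fun g hg => ⟨fun h0 => ?_, fun d hd L => ?_⟩⟩
  · ext L
    exact LinkModule.apply_mem_of_isSolution hg (RatFun.isStable_bot τ q) h0 L
  · exact LinkModule.apply_mem_of_isSolution hg (RatFun.isStable_homogeneous τ q d) hd L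
  · ext L
    exact LinkModule.apply_mem_of_isRestrictedSolution hg (RatFun.isStable_bot τ q) h0 L
  · exact LinkModule.apply_mem_of_isRestrictedSolution hg (RatFun.isStable_homogeneous τ q d) hd L
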